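/- Let $X=\{x_1,\dots,x_n\}$. For a field $\mathbb{F}$ let $\mathbb{F}\langle X,X^{-1}\rangle$ be the free group algebra, whose elements are the finite sums $f=\sum_w \alpha_w w$ with $\alpha_w\in\mathbb{F}$ and $w$ ranging over the reduced words in $x_1^{\pm1},\dots,x_n^{\pm1}$. The degree of $f$ is the maximal length of a reduced word $w$ with $\alpha_w\neq 0$, and its sparsity is the number of reduced words $w$ with $\alpha_w\ne 0$. A black box for $f$ answers a query consisting of a dimension $k$ and invertible matrices $A_1,\dots,A_n\in\mathbb{M}_k(\mathbb{F})$ with the matrix $f(A_1,\dots,A_n)\in\mathbb{M}_k(\mathbb{F})$. Consider deterministic random access machines whose time counts every field operation and every equality test in $\mathbb{F}$, and every memory access, addition or subtraction of natural numbers, as one step, charges multiplications and divisions of natural numbers by bit length, and charges a query by the number of matrix entries that are read and written. There are a deterministic machine of this kind, using no field constants other than $0$ and $1$, and a polynomial $p$ such that for every field $\mathbb{F}$ of characteristic zero, all $n,d,s\in\mathbb{N}$, and every $f\in\mathbb{F}\langle X,X^{-1}\rangle$ of degree at most $d$ and sparsity at most $s$, given $n,d,s$ and a black box for $f$ the machine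 halts within $p(n,d,s)$ steps and outputs the sparse representation of $f$, that is, the list of all reduced words $w$ with $\alpha_w\ne0$, each exactly once and together with its coefficient $\alpha_w$. Likewise there are such a deterministic machine and a polynomial $p$ such that, for all the same $\mathbb{F},n,d,s,f$, given $n,d,s$ and a black box for $f$ the machine decides within $p(n,d,s)$ steps whether $f=0$. -/

import Mathlib

/-! ## The free group algebra and black-box evaluation -/

/-- `F⟨X, X⁻¹⟩` with `X = {x_0, …, x_{n-1}}`: finite `F`-linear combinations of elements of the
free group on `X`, that is, of reduced words. -/
abbrev FreeGroupAlgebra (F : Type*) [Field F] (n : ℕ) : Type _ :=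
  MonoidAlgebra F (FreeGroup (Fin n))

namespace FreeGroupAlgebra

variable {F : Type*} [Field F] {n : ℕ}

/-- The maximal length of a reduced word with nonzero coefficient (`0` for the zero expression). -/
def degree (f : FreeGroupAlgebra F n) : ℕ :=
  f.coeff.support.sup FreeGroup.norm

/-- The number of reduced words with nonzero coefficient. -/
def sparsity (f : FreeGroupAlgebra F n) : ℕ :=
  f.coeff.support.card

/-- `f(A_0, …, A_{n-1})` for invertible `k × k` matrices `A_i`: the value of `f` under the
`F`-algebra homomorphism that sends `x_i` to `A_i` (hence `x_i⁻¹` to `A_i⁻¹`). -/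
noncomputable def evalMatrix (f : FreeGroupAlgebra F n) (k : ℕ)
    (A : Fin n → (Matrix (Fin k) (Fin k) F)ˣ) : Matrix (Fin k) (Fin k) F :=
  MonoidAlgebra.lift F (Matrix (Fin k) (Fin k) F) (FreeGroup (Fin n))
    ((Units.coeHom (Matrix (Fin k) (Fin k) F)).comp (FreeGroup.lift A)) f

end FreeGroupAlgebra

/-! ## Algebraic random access machines with a matrix-valued oracle

A program works on two kinds of memory: arrays of natural numbers (indices, counters, codes of
letters) and arrays of field elements.  It is a fixed finite text, with no constants from the
field other than `0` and `1`; in particular the same text can be run over every field. -/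

namespace AlgRAM

/-- Memory: countably many arrays of natural numbers and countably many arrays of field elements,
`nat a i` and `fld a i` being the cell number `i` of the array `a`. -/
@[ext]
structure State (F : Type*) where
  nat : ℕ → ℕ → ℕ
  fld : ℕ → ℕ → F

/-- Natural number expressions; `get a i` reads the cell `i` of the array `a`. -/
inductive NExp where
  | const (c : ℕ)
  | get (a : ℕ) (i : NExp)
  | add (x y : NExp)
  | sub (x y : NExp)
  | mul (x y : NExp)
  | div (x y : NExp)
  | mod (x y : NExp)

/-- Field expressions; `get a i` reads the cell `i` of the array `a`. -/
inductive FExp where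
  | zero
  | one
  | get (a : ℕ) (i : NExp)
  | add (x y : FExp)
  | sub (x y : FExp)
  | mul (x y : FExp)
  | inv (x : FExp)

/-- Tests. -/
inductive Test where
  | natLt (x y : NExp)
  | natEq (x y : NExp)
  | fldEq (x y : FExp)

/-- Programs. `setNat a i e` and `setFld a i e` write the value of `e` into the cell `i` of the
array `a`. `query k a b` reads `n` matrices of dimension `k × k` from the field array `a`, asks the
oracle for the value at these matrices, and writes the answer into the field array `b`. -/
inductive Prog where
  | skip
  | setNat (a : ℕ) (i e : NExp)
  | setFld (a : ℕ) (i : NExp) (e : FExp)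
  | seq (P Q : Prog)
  | ite (c : Test) (P Q : Prog)
  | loop (c : Test) (P : Prog)
  | query (k : NExp) (a b : ℕ)

variable {F : Type*}

/-- Value of a natural number expression (truncated subtraction, `x / 0 = 0`, `x % 0 = x`). -/
def NExp.eval (σ : State F) : NExp → ℕ
  | const c => c
  | get a i => σ.nat a (i.eval σ)
  | add x y => x.eval σ + y.eval σ
  | sub x y => x.eval σ - y.eval σ
  | mul x y => x.eval σ * y.eval σ
  | div x y => x.eval σ / y.eval σ
  | mod x y => x.eval σ % y.eval σ

/-- Time for evaluating a natural number expression. Constants, memory accesses, additions and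
subtractions cost one step; multiplications, divisions and remainders are charged the bit lengths
of their operands (so that long numbers cannot be produced or processed in few steps). -/
def NExp.cost (σ : State F) : NExp → ℕ
  | const _ => 1
  | get _ i => i.cost σ + 1
  | add x y => x.cost σ + y.cost σ + 1
  | sub x y => x.cost σ + y.cost σ + 1
  | mul x y => x.cost σ + y.cost σ + 1 + Nat.size (x.eval σ) + Nat.size (y.eval σ)
  | div x y => x.cost σ + y.cost σ + 1 + Nat.size (x.eval σ) + Nat.size (y.eval σ)
  | mod x y => x.cost σ + y.cost σ + 1 + Nat.size (x.eval σ) + Nat.size (y.eval σ)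

/-- Value of a field expression (with `0⁻¹ = 0`). -/
def FExp.eval [Field F] (σ : State F) : FExp → F
  | zero => 0
  | one => 1
  | get a i => σ.fld a (i.eval σ)
  | add x y => x.eval σ + y.eval σ
  | sub x y => x.eval σ - y.eval σ
  | mul x y => x.eval σ * y.eval σ
  | inv x => (x.eval σ)⁻¹

/-- Time for evaluating a field expression: every operation of the field costs one step. -/
def FExp.cost (σ : State F) : FExp → ℕ
  | zero => 1
  | one => 1
  | get _ i => i.cost σ + 1
  | add x y => x.cost σ + y.cost σ + 1
  | sub x y => x.cost σ + y.cost σ + 1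
  | mul x y => x.cost σ + y.cost σ + 1
  | inv x => x.cost σ + 1

/-- Truth of a test. -/
def Test.holds [Field F] (σ : State F) : Test → Prop
  | natLt x y => x.eval σ < y.eval σ
  | natEq x y => x.eval σ = y.eval σ
  | fldEq x y => x.eval σ = y.eval σ

/-- Time for a test. -/
def Test.cost (σ : State F) : Test → ℕ
  | natLt x y => x.cost σ + y.cost σ + 1
  | natEq x y => x.cost σ + y.cost σ + 1
  | fldEq x y => x.cost σ + y.cost σ + 1

/-- Write a natural number into a cell. -/
def State.setNat (σ : State F) (a i v : ℕ) : State F where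
  nat := fun b j => if b = a ∧ j = i then v else σ.nat b j
  fld := σ.fld

/-- Write a field element into a cell. -/
def State.setFld (σ : State F) (a i : ℕ) (v : F) : State F where
  nat := σ.nat
  fld := fun b j => if b = a ∧ j = i then v else σ.fld b j

/-- The `i`-th `k × k` matrix stored in the field array `a`: its entry in row `p` and column `q`
is in the cell `(i * k + p) * k + q`. -/
def State.readMatrix (σ : State F) (a k i : ℕ) : Matrix (Fin k) (Fin k) F :=
  Matrix.of fun p q => σ.fld a ((i * k + p) * k + q)

/-- Write a `k × k` matrix into the field array `a`: the entry in row `p` and column `q` goes into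
the cell `p * k + q`. -/
def State.writeMatrix (σ : State F) (a k : ℕ) (R : Matrix (Fin k) (Fin k) F) : State F where
  nat := σ.nat
  fld := fun b j =>
    if h : b = a ∧ j < k * k then
      R (finProdFinEquiv.symm ⟨j, h.2⟩).1 (finProdFinEquiv.symm ⟨j, h.2⟩).2
    else σ.fld b j

/-- A black box in `n` variables: it maps every `n`-tuple of invertible matrices of a common
dimension `k` to a matrix of dimension `k`. -/
abbrev Oracle (F : Type*) [Field F] (n : ℕ) : Type _ :=
  ∀ k : ℕ, (Fin n → (Matrix (Fin k) (Fin k) F)ˣ) → Matrix (Fin k) (Fin k) F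

/-- `Run O P σ t τ`: started in the memory `σ`, the program `P` with oracle `O` halts after exactly
`t` steps with the memory `τ`.  A query is possible only at invertible matrices (otherwise the
program does not halt properly), and it costs as many steps as matrix entries are read and
written. -/
inductive Run [Field F] {n : ℕ} (O : Oracle F n) : Prog → State F → ℕ → State F → Prop
  | skip (σ : State F) : Run O Prog.skip σ 1 σ
  | setNat (a : ℕ) (i e : NExp) (σ : State F) :
      Run O (Prog.setNat a i e) σ (i.cost σ + e.cost σ + 1) (σ.setNat a (i.eval σ) (e.eval σ))
  | setFld (a : ℕ) (i : NExp) (e : FExp) (σ : State F) :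
      Run O (Prog.setFld a i e) σ (i.cost σ + e.cost σ + 1) (σ.setFld a (i.eval σ) (e.eval σ))
  | seq {P Q : Prog} {σ τ υ : State F} {t u : ℕ} :
      Run O P σ t τ → Run O Q τ u υ → Run O (Prog.seq P Q) σ (t + u) υ
  | iteTrue {c : Test} {P : Prog} (Q : Prog) {σ τ : State F} {t : ℕ} :
      c.holds σ → Run O P σ t τ → Run O (Prog.ite c P Q) σ (c.cost σ + t) τ
  | iteFalse {c : Test} (P : Prog) {Q : Prog} {σ τ : State F} {t : ℕ} :
      ¬ c.holds σ → Run O Q σ t τ → Run O (Prog.ite c P Q) σ (c.cost σ + t) τ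
  | loopDone {c : Test} (P : Prog) {σ : State F} :
      ¬ c.holds σ → Run O (Prog.loop c P) σ (c.cost σ) σ
  | loopStep {c : Test} {P : Prog} {σ τ υ : State F} {t u : ℕ} :
      c.holds σ → Run O P σ t τ → Run O (Prog.loop c P) τ u υ →
        Run O (Prog.loop c P) σ (c.cost σ + t + u) υ
  | query {k : NExp} (a b : ℕ) {σ : State F} {m : ℕ} {A : Fin n → (Matrix (Fin m) (Fin m) F)ˣ} :
      k.eval σ = m → (∀ i : Fin n, (A i : Matrix (Fin m) (Fin m) F) = σ.readMatrix a m i) →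
      Run O (Prog.query k a b) σ (k.cost σ + n * (m * m) + m * m + 1)
        (σ.writeMatrix b m (O m A))

/-- The machine is deterministic: running time and final memory are functions of the program,
the oracle and the initial memory. -/
theorem Run.deterministic [Field F] {n : ℕ} {O : Oracle F n} {P : Prog} {σ τ τ' : State F}
    {t t' : ℕ} (h : Run O P σ t τ) (h' : Run O P σ t' τ') : t = t' ∧ τ = τ' := by
  induction h generalizing t' τ' with
  | skip σ => cases h'; exact ⟨rfl, rfl⟩
  | setNat a i e σ => cases h'; exact ⟨rfl, rfl⟩
  | setFld a i e σ => cases h'; exact ⟨rfl, rfl⟩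
  | seq _ _ ih1 ih2 =>
    cases h' with
    | seq g1 g2 =>
      obtain ⟨rfl, rfl⟩ := ih1 g1
      obtain ⟨rfl, rfl⟩ := ih2 g2
      exact ⟨rfl, rfl⟩
  | iteTrue Q hc _ ih =>
    cases h' with
    | iteTrue _ _ g => obtain ⟨rfl, rfl⟩ := ih g; exact ⟨rfl, rfl⟩
    | iteFalse _ hn _ => exact absurd hc hn
  | iteFalse P hc _ ih =>
    cases h' with
    | iteTrue _ hn _ => exact absurd hn hc
    | iteFalse _ _ g => obtain ⟨rfl, rfl⟩ := ih g; exact ⟨rfl, rfl⟩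
  | loopDone P hc =>
    cases h' with
    | loopDone _ _ => exact ⟨rfl, rfl⟩
    | loopStep hn _ _ => exact absurd hn hc
  | loopStep hc _ _ ih1 ih2 =>
    cases h' with
    | loopDone _ hn => exact absurd hc hn
    | loopStep _ g1 g2 =>
      obtain ⟨rfl, rfl⟩ := ih1 g1
      obtain ⟨rfl, rfl⟩ := ih2 g2
      exact ⟨rfl, rfl⟩
  | query a b hm hA =>
    cases h' with
    | query _ _ hm' hB =>
      subst hm
      subst hm'
      obtain rfl := funext fun i => Units.ext ((hA i).trans (hB i).symm)
      exact ⟨rfl, rfl⟩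

/-! ## Input and output conventions -/

/-- Initial memory on input `(n, d, s)`: the three numbers are in the cells `0, 1, 2` of the array
`0` of natural numbers, and all other cells contain `0`. -/
def init (F : Type*) [Field F] (n d s : ℕ) : State F where
  nat := fun a i =>
    if a = 0 ∧ i = 0 then n else if a = 0 ∧ i = 1 then d else if a = 0 ∧ i = 2 then s else 0
  fld := fun _ _ => 0

/-- The answer of a decision procedure: the cell `0` of the array `1` of natural numbers. -/
def State.answer (σ : State F) : ℕ := σ.nat 1 0

/-- The list of pairs (coefficient, word) written by a reconstruction procedure, where the words
are lists of natural numbers. The number of pairs is in the cell `0` of the array `1` of natural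
numbers; the coefficient of the `t`-th pair is in the cell `t` of the field array `0`, the length
of its word is in the cell `t` of the array `2` of natural numbers, and its word is stored in the
array `3` of natural numbers from the cell `t * d` on. -/
def State.terms (σ : State F) (d : ℕ) : List (F × List ℕ) :=
  (List.range (σ.nat 1 0)).map fun t =>
    (σ.fld 0 t, (List.range (σ.nat 2 t)).map fun j => σ.nat 3 (t * d + j))

/-- Code of a letter: `2 i` for `x_i` (the pair `(i, true)`), `2 i + 1` for `x_i⁻¹`. -/
def letterCode {n : ℕ} (l : Fin n × Bool) : ℕ := 2 * l.1 + (if l.2 then 0 else 1)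

/-- `L` is the sparse representation of `f`: a list, without repetition, of exactly those reduced
words that have a nonzero coefficient in `f`, each together with this coefficient. -/
def IsSparseRepresentation [Field F] {n : ℕ} (L : List (F × List ℕ)) (f : FreeGroupAlgebra F n) :
    Prop :=
  ∃ l : List (FreeGroup (Fin n)), l.Nodup ∧ (∀ w, w ∈ l ↔ f.coeff w ≠ 0) ∧
    L = l.map fun w => (f.coeff w, w.toWord.map letterCode)

end AlgRAM

/-! The group is represented on a space of dimension 4(d+1), divided into levels 0, …, d. Each level
has two sides, and each side has dimension two. A letter l acts by S + N(l). Here S exchanges the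
sides of every level, and N(l) leads from level t to level t+1. On side 0 the block of N(l) is
±W(t,l) col(l) row(l); on side 1 the letter l is replaced by its inverse l' in this block, and the
sign is kept. The sign changes with the inversion of the letter, so S N(l') = -N(l) S. Since row(l)
· col(l') = 0, also N(l) N(l') = 0. Hence S + N(l) and S + N(l') are inverse to each other for every
choice of the weights W (`letterMatrix_mul`).

In K steps the level K is reached only by rising at every step, hence without changing the side. The
entry in row 0 and column 4K therefore vanishes for words shorter than K. For a reduced word w of
length K it is a nonzero constant times the product of the weights W(t, w_t) (`exists_wordVec_eq`):
the constant is built from the pairings row(m) · col(l), which in characteristic zero vanish only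
for l = m'. If no word is longer than K, this entry isolates the words of length K.

Weights 0 and 1 on the first m levels select a prefix. On the other levels the letter l gets the
weight (2^((2n)^t))^(l k), so a selected word contributes a multiple of the k-th power of 2^E, where
E has the letters as digits in base 2n. Different words have different E, and by a Vandermonde
argument the exponents k < s decide whether a word with this prefix occurs
(`exists_testValue_ne_zero_iff`).

The algorithm treats the lengths K = d, …, 0. It subtracts the terms already found from the answers
of the black box, extends a prefix letter by letter by means of this test, and obtains the
coefficient by dividing the last value by the value of the word found, which the machine computes
itself (`exec_roundCmd`, `exec_mainCmd`). At most s terms and 2n candidates for each letter keep the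
number of queries polynomial. The large numbers 2^((2n)^t) occur only in the field, where an
operation costs one step, and arise by repeated multiplication.

For the running time, programs are written with bounded loops only; a syntactic check then yields
termination and a polynomial bound (`Cmd.run`), so that correctness can be proved for the function
`Cmd.exec`. Deciding f = 0 amounts to comparing the number of terms with zero. -/

namespace AlgRAM

/-! ### Structured programs, their semantics and their running time -/

/-- The natural number register `r`, that is, the cell `0` of the array `r`. -/
abbrev NExp.reg (r : ℕ) : NExp := .get r (.const 0)

/-- The field register `r`, that is, the cell `0` of the field array `r`. -/
abbrev FExp.reg (r : ℕ) : FExp := .get r (.const 0)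

/-- Structured programs: `loop v r P` runs `P` for the values `0, 1, …` of the register `v` below
the content of the register `r`. -/
inductive Cmd where
  | setNat (a : ℕ) (i e : NExp)
  | setFld (a : ℕ) (i : NExp) (e : FExp)
  | seq (P Q : Cmd)
  | ite (c : Test) (P Q : Cmd)
  | loop (v r : ℕ) (P : Cmd)
  | query (k a b : ℕ)
  | skip

/-- The expression is built from constants and registers in `Γ`. -/
def NExp.small (Γ : List ℕ) : NExp → Bool
  | const _ => true
  | get a (const 0) => decide (a ∈ Γ)
  | get _ _ => false
  | add x y => x.small Γ && y.small Γ
  | sub x y => x.small Γ && y.small Γ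
  | mul x y => x.small Γ && y.small Γ
  | div x y => x.small Γ && y.small Γ
  | mod x y => x.small Γ && y.small Γ

/-- Bound for the value of a small expression in a bound for the registers. -/
noncomputable def NExp.bound : NExp → Polynomial ℕ
  | const c => Polynomial.C c
  | get _ _ => Polynomial.X
  | add x y => x.bound + y.bound
  | sub x _ => x.bound
  | mul x y => x.bound * y.bound
  | div x _ => x.bound
  | mod x _ => x.bound

/-- Multiplications and divisions are applied to small expressions only. -/
def NExp.ok (Γ : List ℕ) : NExp → Bool
  | const _ => true
  | get _ i => i.ok Γ
  | add x y => x.ok Γ && y.ok Γ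
  | sub x y => x.ok Γ && y.ok Γ
  | mul x y => x.ok Γ && y.ok Γ && x.small Γ && y.small Γ
  | div x y => x.ok Γ && y.ok Γ && x.small Γ && y.small Γ
  | mod x y => x.ok Γ && y.ok Γ && x.small Γ && y.small Γ

/-- The bit length of an operand is estimated by the operand itself, so a bound for its value serves
as a bound for the charge. -/
noncomputable def NExp.time : NExp → Polynomial ℕ
  | const _ => 1
  | get _ i => i.time + 1
  | add x y => x.time + y.time + 1
  | sub x y => x.time + y.time + 1
  | mul x y => x.time + y.time + 1 + x.bound + y.bound
  | div x y => x.time + y.time + 1 + x.bound + y.bound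
  | mod x y => x.time + y.time + 1 + x.bound + y.bound

def FExp.ok (Γ : List ℕ) : FExp → Bool
  | zero => true
  | one => true
  | get _ i => i.ok Γ
  | add x y => x.ok Γ && y.ok Γ
  | sub x y => x.ok Γ && y.ok Γ
  | mul x y => x.ok Γ && y.ok Γ
  | inv x => x.ok Γ

noncomputable def FExp.time : FExp → Polynomial ℕ
  | zero => 1
  | one => 1
  | get _ i => i.time + 1
  | add x y => x.time + y.time + 1
  | sub x y => x.time + y.time + 1
  | mul x y => x.time + y.time + 1
  | inv x => x.time + 1

def Test.ok (Γ : List ℕ) : Test → Bool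
  | natLt x y => x.ok Γ && y.ok Γ
  | natEq x y => x.ok Γ && y.ok Γ
  | fldEq x y => x.ok Γ && y.ok Γ

noncomputable def Test.time : Test → Polynomial ℕ
  | natLt x y => x.time + y.time + 1
  | natEq x y => x.time + y.time + 1
  | fldEq x y => x.time + y.time + 1

namespace Cmd

def toProg : Cmd → Prog
  | setNat a i e => .setNat a i e
  | setFld a i e => .setFld a i e
  | seq P Q => .seq P.toProg Q.toProg
  | ite c P Q => .ite c P.toProg Q.toProg
  | loop v r P => .seq (.setNat v (.const 0) (.const 0))
      (.loop (.natLt (.reg v) (.reg r))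
        (.seq P.toProg (.setNat v (.const 0) (.add (.reg v) (.const 1)))))
  | query k a b => .query (.reg k) a b
  | skip => .skip

/-- The registers in `Γ` are not written, loops are bounded by registers in `Γ`, and products and
quotients of natural numbers involve registers in `Γ` and loop variables only. -/
def wf : Cmd → List ℕ → Bool
  | setNat a i e, Γ => decide (a ∉ Γ) && i.ok Γ && e.ok Γ
  | setFld _ i e, Γ => i.ok Γ && e.ok Γ
  | seq P Q, Γ => P.wf Γ && Q.wf Γ
  | ite c P Q, Γ => c.ok Γ && P.wf Γ && Q.wf Γ
  | loop v r P, Γ => decide (v ∉ Γ) && decide (r ∈ Γ) && P.wf (v :: Γ)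
  | query k _ _, Γ => decide (k ∈ Γ)
  | skip, _ => true

/-- Bound for the running time in a bound for the registers. -/
noncomputable def time : Cmd → Polynomial ℕ
  | setNat _ i e => i.time + e.time + 1
  | setFld _ i e => i.time + e.time + 1
  | seq P Q => P.time + Q.time
  | ite c P Q => c.time + P.time + Q.time
  | loop _ _ P => Polynomial.X * (P.time + 11) + 8
  | query _ _ _ => 2 + Polynomial.X * (Polynomial.X * Polynomial.X) +
      Polynomial.X * Polynomial.X + 1
  | skip => 1

/-- The arrays of natural numbers that are written. -/
def nats : Cmd → List ℕ
  | setNat a _ _ => [a]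
  | setFld _ _ _ => []
  | seq P Q => P.nats ++ Q.nats
  | ite _ P Q => P.nats ++ Q.nats
  | loop v _ P => v :: P.nats
  | query _ _ _ => []
  | skip => []

/-- The field arrays that are written. -/
def flds : Cmd → List ℕ
  | setNat _ _ _ => []
  | setFld a _ _ => [a]
  | seq P Q => P.flds ++ Q.flds
  | ite _ P Q => P.flds ++ Q.flds
  | loop _ _ P => P.flds
  | query _ _ b => [b]
  | skip => []

end Cmd

variable {F : Type*}

/-- The memory after `i` rounds of a loop with body `f` and loop variable `v`. -/
def loopState (f : State F → State F) (v : ℕ) (σ : State F) : ℕ → State F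
  | 0 => σ.setNat v 0 0
  | i + 1 => (f (loopState f v σ i)).setNat v 0 (i + 1)

section Bounds

variable {Γ : List ℕ} {σ : State F} {B : ℕ}

theorem NExp.eval_le_bound (hΓ : ∀ r ∈ Γ, σ.nat r 0 ≤ B) :
    ∀ e : NExp, e.small Γ = true → e.eval σ ≤ e.bound.eval B
  | const c, _ => by simp [NExp.eval, NExp.bound]
  | get a (const 0), h => by
    simp only [NExp.small, decide_eq_true_eq] at h
    simpa [NExp.eval, NExp.bound] using hΓ a h
  | add x y, h => by
    simp only [NExp.small, Bool.and_eq_true] at h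
    simpa [NExp.eval, NExp.bound] using
      Nat.add_le_add (eval_le_bound hΓ x h.1) (eval_le_bound hΓ y h.2)
  | sub x y, h => by
    simp only [NExp.small, Bool.and_eq_true] at h
    exact (Nat.sub_le _ _).trans (eval_le_bound hΓ x h.1)
  | mul x y, h => by
    simp only [NExp.small, Bool.and_eq_true] at h
    simpa [NExp.eval, NExp.bound] using
      Nat.mul_le_mul (eval_le_bound hΓ x h.1) (eval_le_bound hΓ y h.2)
  | div x y, h => by
    simp only [NExp.small, Bool.and_eq_true] at h
    exact (Nat.div_le_self _ _).trans (eval_le_bound hΓ x h.1)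
  | mod x y, h => by
    simp only [NExp.small, Bool.and_eq_true] at h
    exact (Nat.mod_le _ _).trans (eval_le_bound hΓ x h.1)

theorem size_le_self (m : ℕ) : Nat.size m ≤ m := Nat.size_le.2 Nat.lt_two_pow_self

theorem NExp.size_eval_le (hΓ : ∀ r ∈ Γ, σ.nat r 0 ≤ B) (e : NExp) (h : e.small Γ = true) :
    Nat.size (e.eval σ) ≤ e.bound.eval B :=
  (size_le_self _).trans (e.eval_le_bound hΓ h)

theorem NExp.cost_le_time (hΓ : ∀ r ∈ Γ, σ.nat r 0 ≤ B) :
    ∀ e : NExp, e.ok Γ = true → e.cost σ ≤ e.time.eval B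
  | const c, _ => by simp [NExp.cost, NExp.time]
  | get a i, h => by
    have := cost_le_time hΓ i h
    simpa [NExp.cost, NExp.time] using this
  | add x y, h => by
    simp only [NExp.ok, Bool.and_eq_true] at h
    have := cost_le_time hΓ x h.1
    have := cost_le_time hΓ y h.2
    simp only [NExp.cost, NExp.time, Polynomial.eval_add, Polynomial.eval_one]; omega
  | sub x y, h => by
    simp only [NExp.ok, Bool.and_eq_true] at h
    have := cost_le_time hΓ x h.1
    have := cost_le_time hΓ y h.2
    simp only [NExp.cost, NExp.time, Polynomial.eval_add, Polynomial.eval_one]; omega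
  | mul x y, h => by
    simp only [NExp.ok, Bool.and_eq_true] at h
    have := cost_le_time hΓ x h.1.1.1
    have := cost_le_time hΓ y h.1.1.2
    have := x.size_eval_le hΓ h.1.2
    have := y.size_eval_le hΓ h.2
    simp only [NExp.cost, NExp.time, Polynomial.eval_add, Polynomial.eval_one]; omega
  | div x y, h => by
    simp only [NExp.ok, Bool.and_eq_true] at h
    have := cost_le_time hΓ x h.1.1.1
    have := cost_le_time hΓ y h.1.1.2
    have := x.size_eval_le hΓ h.1.2
    have := y.size_eval_le hΓ h.2
    simp only [NExp.cost, NExp.time, Polynomial.eval_add, Polynomial.eval_one]; omega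
  | mod x y, h => by
    simp only [NExp.ok, Bool.and_eq_true] at h
    have := cost_le_time hΓ x h.1.1.1
    have := cost_le_time hΓ y h.1.1.2
    have := x.size_eval_le hΓ h.1.2
    have := y.size_eval_le hΓ h.2
    simp only [NExp.cost, NExp.time, Polynomial.eval_add, Polynomial.eval_one]; omega

theorem FExp.cost_le_time (hΓ : ∀ r ∈ Γ, σ.nat r 0 ≤ B) :
    ∀ e : FExp, e.ok Γ = true → e.cost σ ≤ e.time.eval B
  | zero, _ => by simp [FExp.cost, FExp.time]
  | one, _ => by simp [FExp.cost, FExp.time]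
  | get a i, h => by
    have := i.cost_le_time hΓ h
    simpa [FExp.cost, FExp.time] using this
  | add x y, h => by
    simp only [FExp.ok, Bool.and_eq_true] at h
    have := cost_le_time hΓ x h.1
    have := cost_le_time hΓ y h.2
    simp only [FExp.cost, FExp.time, Polynomial.eval_add, Polynomial.eval_one]; omega
  | sub x y, h => by
    simp only [FExp.ok, Bool.and_eq_true] at h
    have := cost_le_time hΓ x h.1
    have := cost_le_time hΓ y h.2
    simp only [FExp.cost, FExp.time, Polynomial.eval_add, Polynomial.eval_one]; omega
  | mul x y, h => by
    simp only [FExp.ok, Bool.and_eq_true] at h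
    have := cost_le_time hΓ x h.1
    have := cost_le_time hΓ y h.2
    simp only [FExp.cost, FExp.time, Polynomial.eval_add, Polynomial.eval_one]; omega
  | inv x, h => by
    have := cost_le_time hΓ x h
    simpa [FExp.cost, FExp.time] using this

theorem Test.cost_le_time (hΓ : ∀ r ∈ Γ, σ.nat r 0 ≤ B) (c : Test) (h : c.ok Γ = true) :
    c.cost σ ≤ c.time.eval B := by
  cases c with
  | natLt x y =>
    simp only [Test.ok, Bool.and_eq_true] at h
    have := x.cost_le_time hΓ h.1
    have := y.cost_le_time hΓ h.2
    simp only [Test.cost, Test.time, Polynomial.eval_add, Polynomial.eval_one]; omega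
  | natEq x y =>
    simp only [Test.ok, Bool.and_eq_true] at h
    have := x.cost_le_time hΓ h.1
    have := y.cost_le_time hΓ h.2
    simp only [Test.cost, Test.time, Polynomial.eval_add, Polynomial.eval_one]; omega
  | fldEq x y =>
    simp only [Test.ok, Bool.and_eq_true] at h
    have := x.cost_le_time hΓ h.1
    have := y.cost_le_time hΓ h.2
    simp only [Test.cost, Test.time, Polynomial.eval_add, Polynomial.eval_one]; omega

end Bounds

@[simp] theorem State.setNat_nat (σ : State F) (a i v b j : ℕ) :
    (σ.setNat a i v).nat b j = if b = a ∧ j = i then v else σ.nat b j := rfl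

@[simp] theorem State.setNat_fld (σ : State F) (a i v : ℕ) : (σ.setNat a i v).fld = σ.fld := rfl

@[simp] theorem State.setFld_nat (σ : State F) (a i : ℕ) (v : F) :
    (σ.setFld a i v).nat = σ.nat := rfl

@[simp] theorem State.setFld_fld (σ : State F) (a i : ℕ) (v : F) (b j : ℕ) :
    (σ.setFld a i v).fld b j = if b = a ∧ j = i then v else σ.fld b j := rfl

theorem State.setNat_nat_of_ne (σ : State F) {a i v b : ℕ} (h : b ≠ a) :
    (σ.setNat a i v).nat b = σ.nat b := by
  funext j; simp [h]

theorem State.setFld_fld_of_ne (σ : State F) {a i b : ℕ} {v : F} (h : b ≠ a) :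
    (σ.setFld a i v).fld b = σ.fld b := by
  funext j; simp [h]

theorem loopState_self (f : State F → State F) (v : ℕ) (σ : State F) (i : ℕ) :
    (loopState f v σ i).nat v 0 = i := by
  cases i <;> simp [loopState]

variable [Field F] {n : ℕ}

open Classical in
/-- The final memory of a structured program. -/
noncomputable def Cmd.exec (O : Oracle F n) : Cmd → State F → State F
  | setNat a i e, σ => σ.setNat a (i.eval σ) (e.eval σ)
  | setFld a i e, σ => σ.setFld a (i.eval σ) (e.eval σ)
  | seq P Q, σ => Q.exec O (P.exec O σ)
  | ite c P Q, σ => if c.holds σ then P.exec O σ else Q.exec O σ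
  | loop v r P, σ => loopState (P.exec O) v σ (σ.nat r 0)
  | query k a b, σ =>
      if h : ∃ A : Fin n → (Matrix (Fin (σ.nat k 0)) (Fin (σ.nat k 0)) F)ˣ,
          ∀ i : Fin n, (A i : Matrix _ _ F) = σ.readMatrix a (σ.nat k 0) i then
        σ.writeMatrix b (σ.nat k 0) (O (σ.nat k 0) h.choose)
      else σ
  | skip, σ => σ

/-- All queries are at invertible matrices. -/
def Cmd.Safe (O : Oracle F n) : Cmd → State F → Prop
  | seq P Q, σ => P.Safe O σ ∧ Q.Safe O (P.exec O σ)
  | ite c P Q, σ => (c.holds σ → P.Safe O σ) ∧ (¬ c.holds σ → Q.Safe O σ)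
  | loop v r P, σ => ∀ i < σ.nat r 0, P.Safe O (loopState (P.exec O) v σ i)
  | query k a _, σ => ∃ A : Fin n → (Matrix (Fin (σ.nat k 0)) (Fin (σ.nat k 0)) F)ˣ,
      ∀ i : Fin n, (A i : Matrix _ _ F) = σ.readMatrix a (σ.nat k 0) i
  | _, _ => True

/-- Arrays that are not listed are not changed. -/
theorem Cmd.exec_nat (O : Oracle F n) :
    ∀ (P : Cmd) (σ : State F) {a : ℕ}, a ∉ P.nats → (P.exec O σ).nat a = σ.nat a
  | setNat b i e, σ, a, h => State.setNat_nat_of_ne _ (by simpa [nats] using h)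
  | setFld _ _ _, _, _, _ => rfl
  | seq P Q, σ, a, h => by
    simp only [nats, List.mem_append, not_or] at h
    exact (exec_nat O Q _ h.2).trans (exec_nat O P σ h.1)
  | ite c P Q, σ, a, h => by
    simp only [nats, List.mem_append, not_or] at h
    unfold exec
    split
    · exact exec_nat O P σ h.1
    · exact exec_nat O Q σ h.2
  | loop v r P, σ, a, h => by
    simp only [nats, List.mem_cons, not_or] at h
    unfold exec
    generalize σ.nat r 0 = b
    induction b with
    | zero => exact State.setNat_nat_of_ne _ h.1
    | succ i ih => exact (State.setNat_nat_of_ne _ h.1).trans ((exec_nat O P _ h.2).trans ih)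
  | query k b c, σ, a, _ => by
    unfold exec
    split <;> rfl
  | skip, _, _, _ => rfl

theorem Cmd.exec_fld (O : Oracle F n) :
    ∀ (P : Cmd) (σ : State F) {a : ℕ}, a ∉ P.flds → (P.exec O σ).fld a = σ.fld a
  | setNat _ _ _, _, _, _ => rfl
  | setFld b i e, σ, a, h => State.setFld_fld_of_ne _ (by simpa [flds] using h)
  | seq P Q, σ, a, h => by
    simp only [flds, List.mem_append, not_or] at h
    exact (exec_fld O Q _ h.2).trans (exec_fld O P σ h.1)
  | ite c P Q, σ, a, h => by
    simp only [flds, List.mem_append, not_or] at h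
    unfold exec
    split
    · exact exec_fld O P σ h.1
    · exact exec_fld O Q σ h.2
  | loop v r P, σ, a, h => by
    unfold exec
    generalize σ.nat r 0 = b
    induction b with
    | zero => rfl
    | succ i ih => exact (exec_fld O P _ h).trans ih
  | query k b c, σ, a, h => by
    unfold exec
    split
    · funext j
      have : a ≠ c := by simpa [flds] using h
      simp [State.writeMatrix, this]
    · rfl
  | skip, _, _, _ => rfl

/-- Protected registers are not written. -/
theorem Cmd.notMem_nats_of_wf : ∀ (P : Cmd) {Γ : List ℕ}, P.wf Γ = true → ∀ r ∈ Γ, r ∉ P.nats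
  | setNat b i e, Γ, h, r, hr => by
    simp only [wf, Bool.and_eq_true, decide_eq_true_eq] at h
    simp only [nats, List.mem_singleton]
    rintro rfl
    exact h.1.1 hr
  | setFld _ _ _, _, _, _, _ => by simp [nats]
  | seq P Q, Γ, h, r, hr => by
    simp only [wf, Bool.and_eq_true] at h
    simp [nats, notMem_nats_of_wf P h.1 r hr, notMem_nats_of_wf Q h.2 r hr]
  | ite c P Q, Γ, h, r, hr => by
    simp only [wf, Bool.and_eq_true] at h
    simp [nats, notMem_nats_of_wf P h.1.2 r hr, notMem_nats_of_wf Q h.2 r hr]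
  | loop v b P, Γ, h, r, hr => by
    simp only [wf, Bool.and_eq_true, decide_eq_true_eq] at h
    simp only [nats, List.mem_cons, not_or]
    refine ⟨?_, notMem_nats_of_wf P h.2 r (List.mem_cons_of_mem _ hr)⟩
    rintro rfl
    exact h.1.1 hr
  | query _ _ _, _, _, _, _ => by simp [nats]
  | skip, _, _, _, _ => by simp [nats]

/-- A well-formed structured program halts with the memory `exec` within time `time`. -/
theorem Cmd.run (O : Oracle F n) {B : ℕ} (hn : n ≤ B) :
    ∀ (P : Cmd) {Γ : List ℕ} (σ : State F), P.wf Γ = true → (∀ r ∈ Γ, σ.nat r 0 ≤ B) →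
      P.Safe O σ → ∃ t ≤ P.time.eval B, Run O P.toProg σ t (P.exec O σ)
  | setNat a i e, Γ, σ, h, hΓ, _ => by
    simp only [wf, Bool.and_eq_true, decide_eq_true_eq] at h
    refine ⟨_, ?_, Run.setNat a i e σ⟩
    have := i.cost_le_time hΓ h.1.2
    have := e.cost_le_time hΓ h.2
    simp only [time, Polynomial.eval_add, Polynomial.eval_one]; omega
  | setFld a i e, Γ, σ, h, hΓ, _ => by
    simp only [wf, Bool.and_eq_true] at h
    refine ⟨_, ?_, Run.setFld a i e σ⟩
    have := i.cost_le_time hΓ h.1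
    have := e.cost_le_time hΓ h.2
    simp only [time, Polynomial.eval_add, Polynomial.eval_one]; omega
  | seq P Q, Γ, σ, h, hΓ, hs => by
    simp only [wf, Bool.and_eq_true] at h
    obtain ⟨t, ht, hP⟩ := run O hn P σ h.1 hΓ hs.1
    obtain ⟨u, hu, hQ⟩ := run O hn Q (P.exec O σ) h.2 (fun r hr => by
      rw [P.exec_nat O σ (P.notMem_nats_of_wf h.1 r hr)]; exact hΓ r hr) hs.2
    refine ⟨_, ?_, Run.seq hP hQ⟩
    simp only [time, Polynomial.eval_add]; omega
  | ite c P Q, Γ, σ, h, hΓ, hs => by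
    simp only [wf, Bool.and_eq_true] at h
    have hc := c.cost_le_time hΓ h.1.1
    by_cases hh : c.holds σ
    · obtain ⟨t, ht, hP⟩ := run O hn P σ h.1.2 hΓ (hs.1 hh)
      refine ⟨c.cost σ + t, ?_, ?_⟩
      · simp only [time, Polynomial.eval_add]; omega
      · simp only [exec, hh, if_true]
        exact Run.iteTrue _ hh hP
    · obtain ⟨t, ht, hQ⟩ := run O hn Q σ h.2 hΓ (hs.2 hh)
      refine ⟨c.cost σ + t, ?_, ?_⟩
      · simp only [time, Polynomial.eval_add]; omega
      · simp only [exec, hh, if_false]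
        exact Run.iteFalse _ hh hQ
  | loop v r P, Γ, σ, h, hΓ, hs => by
    simp only [wf, Bool.and_eq_true, decide_eq_true_eq] at h
    have hvr : r ≠ v := by rintro rfl; exact h.1.1 h.1.2
    have hb := hΓ r h.1.2
    have hst : ∀ i, ∀ q ∈ Γ, (loopState (P.exec O) v σ i).nat q = σ.nat q := by
      intro i q hq
      have hqv : q ≠ v := by rintro rfl; exact h.1.1 hq
      induction i with
      | zero => exact State.setNat_nat_of_ne _ hqv
      | succ i ih =>
        exact (State.setNat_nat_of_ne _ hqv).trans ((P.exec_nat O _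
          (P.notMem_nats_of_wf h.2 q (List.mem_cons_of_mem _ hq))).trans ih)
    have key : ∀ j ≤ σ.nat r 0, ∃ t ≤ 5 + j * (P.time.eval B + 11),
        Run O (.loop (.natLt (.reg v) (.reg r))
          (.seq P.toProg (.setNat v (.const 0) (.add (.reg v) (.const 1)))))
          (loopState (P.exec O) v σ (σ.nat r 0 - j)) t
          (loopState (P.exec O) v σ (σ.nat r 0)) := by
      intro j hj
      induction j with
      | zero =>
        refine ⟨_, ?_, Run.loopDone _ ?_⟩
        · simp [Test.cost, NExp.cost]
        · simp [Test.holds, NExp.eval, loopState_self, hst _ r h.1.2]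
      | succ j ih =>
        obtain ⟨t, ht, hrun⟩ := ih (by omega)
        set i := σ.nat r 0 - (j + 1) with hi
        have hi' : σ.nat r 0 - j = i + 1 := by omega
        rw [hi'] at hrun
        obtain ⟨u, hu, hP⟩ := run O hn P (Γ := v :: Γ) (loopState (P.exec O) v σ i) h.2
          (by
            intro q hq
            rcases List.mem_cons.1 hq with rfl | hq
            · rw [loopState_self]; omega
            · rw [hst i q hq]; exact hΓ q hq) (hs i (by omega))
        -- The body does not write its loop variable, so the increment of the machine agrees with
        -- the value i + 1 that `loopState` assigns.
        have hv : (P.exec O (loopState (P.exec O) v σ i)).nat v 0 = i := by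
          rw [P.exec_nat O _ (P.notMem_nats_of_wf h.2 v (by simp)), loopState_self]
        have hset := Run.setNat (O := O) v (.const 0) (.add (.reg v) (.const 1))
          (P.exec O (loopState (P.exec O) v σ i))
        simp only [NExp.eval, hv, NExp.cost] at hset
        refine ⟨_, ?_, Run.loopStep ?_ (Run.seq hP hset) hrun⟩
        · simp only [Test.cost, NExp.cost]
          have : (j + 1) * (P.time.eval B + 11) = j * (P.time.eval B + 11) + (P.time.eval B + 11) :=
            by ring
          omega
        · simp only [Test.holds, NExp.eval, loopState_self, hst _ r h.1.2]; omega
    obtain ⟨t, ht, hrun⟩ := key _ le_rfl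
    rw [Nat.sub_self] at hrun
    have h0 := Run.setNat (O := O) v (.const 0) (.const 0) σ
    refine ⟨_, ?_, Run.seq h0 hrun⟩
    have : σ.nat r 0 * (P.time.eval B + 11) ≤ B * (P.time.eval B + 11) := by gcongr
    simp only [NExp.cost, time, Polynomial.eval_add, Polynomial.eval_mul, Polynomial.eval_X,
      Polynomial.eval_ofNat]
    omega
  | query k a b, Γ, σ, h, hΓ, hs => by
    simp only [wf, decide_eq_true_eq] at h
    have hk := hΓ k h
    have hs' : ∃ A : Fin n → (Matrix (Fin (σ.nat k 0)) (Fin (σ.nat k 0)) F)ˣ,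
        ∀ i : Fin n, (A i : Matrix _ _ F) = σ.readMatrix a (σ.nat k 0) i := hs
    simp only [exec, dif_pos hs', toProg]
    refine ⟨_, ?_, Run.query a b rfl hs'.choose_spec⟩
    have h1 : σ.nat k 0 * σ.nat k 0 ≤ B * B := by gcongr
    have h2 : n * (σ.nat k 0 * σ.nat k 0) ≤ B * (B * B) := by gcongr
    simp only [NExp.cost, time, Polynomial.eval_add, Polynomial.eval_mul,
      Polynomial.eval_X, Polynomial.eval_ofNat, Polynomial.eval_one]
    omega
  | skip, Γ, σ, _, _, _ => ⟨1, by simp [time], Run.skip σ⟩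

end AlgRAM

namespace AlgRAM

/-! ### A representation of the free group with free weights -/

section Representation

variable {F : Type*} [Field F]

/-- The code of the letter with code `l` (for `s = 0`) or of its inverse (for `s = 1`). -/
def flipCode (s l : ℕ) : ℕ := l + s - 2 * (s * (l % 2))

/-- The sign attached to a letter. -/
def letterSign (l : ℕ) : F := if l % 2 = 0 then 1 else -1

/-- The column vector `(1, l + 1)` of the letter `l`. -/
def colVec (l r : ℕ) : F := ((1 + r * l : ℕ) : F)

/-- The row vector `(l' + 1, -1)` of the letter `l` with inverse `l'`. -/
def rowVec (l r : ℕ) : F := if r = 0 then ((flipCode 1 l + 1 : ℕ) : F) else -1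

/-- Entries of the matrix of the letter `l`.  The index `4 t + 2 s + r` belongs to the level `t`;
the letter exchanges the two sides `s` of a level and leads from the level `t` to the level `t + 1`
with the weight `W t l`. -/
def letterEntry (W : ℕ → ℕ → F) (l p q : ℕ) : F :=
  (if p / 4 = q / 4 ∧ p / 2 % 2 ≠ q / 2 % 2 ∧ p % 2 = q % 2 then 1 else 0) +
  (if q / 4 = p / 4 + 1 ∧ p / 2 % 2 = q / 2 % 2 then
    letterSign l * W (p / 4) (flipCode (p / 2 % 2) l) * colVec (flipCode (p / 2 % 2) l) (p % 2) *
      rowVec (flipCode (p / 2 % 2) l) (q % 2) else 0)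

theorem sum_range_four_mul (g : ℕ → F) (m : ℕ) :
    ∑ q ∈ Finset.range (4 * m), g q =
      ∑ t ∈ Finset.range m, (g (4 * t) + g (4 * t + 1) + g (4 * t + 2) + g (4 * t + 3)) := by
  induction m with
  | zero => simp
  | succ m ih =>
    rw [show 4 * (m + 1) = 4 * m + 1 + 1 + 1 + 1 by ring, Finset.sum_range_succ,
      Finset.sum_range_succ, Finset.sum_range_succ, Finset.sum_range_succ,
      Finset.sum_range_succ _ m, ih]
    ring

theorem flipCode_zero (l : ℕ) : flipCode 0 l = l := by simp [flipCode]

theorem flipCode_flipCode (l : ℕ) : flipCode 1 (flipCode 1 l) = l := by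
  unfold flipCode; omega

theorem letterSign_flipCode (l : ℕ) : letterSign (F := F) (flipCode 1 l) = -letterSign l := by
  unfold flipCode letterSign
  rcases Nat.mod_two_eq_zero_or_one l with h | h
  · rw [if_neg (by omega), if_pos h]
  · rw [if_pos (by omega), if_neg (by omega), neg_neg]

/-- The row vector `v` times the matrix of the letter `l`. -/
def letterStep (W : ℕ → ℕ → F) (d l : ℕ) (v : ℕ → F) (q : ℕ) : F :=
  ∑ p ∈ Finset.range (4 * (d + 1)), v p * letterEntry W l p q

/-- A column has at most three nonzero entries: one from the exchange of the sides, and two from the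
side `s` of the level below, where the coordinates are paired with the column vector `(1, l + 1)` of
the letter acting on that side. -/
theorem letterStep_eq (W : ℕ → ℕ → F) {d l t s r : ℕ} (v : ℕ → F) (ht : t ≤ d) (hs : s < 2)
    (hr : r < 2) :
    letterStep W d l v (4 * t + 2 * s + r) = v (4 * t + 2 * (1 - s) + r) +
      (if t = 0 then 0 else (v (4 * (t - 1) + 2 * s) +
        v (4 * (t - 1) + 2 * s + 1) * (flipCode s l + 1 : ℕ)) *
        (letterSign l * W (t - 1) (flipCode s l) * rowVec (flipCode s l) r)) := by
  unfold letterStep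
  rw [sum_range_four_mul]
  have e0 : (4 * t + 2 * s + r) / 4 = t := by omega
  have e1 : (4 * t + 2 * s + r) / 2 % 2 = s := by omega
  have e2 : (4 * t + 2 * s + r) % 2 = r := by omega
  have a0 (x : ℕ) : 4 * x / 4 = x := by omega
  have a1 (x : ℕ) : (4 * x + 1) / 4 = x := by omega
  have a2 (x : ℕ) : (4 * x + 2) / 4 = x := by omega
  have a3 (x : ℕ) : (4 * x + 3) / 4 = x := by omega
  have b0 (x : ℕ) : 4 * x / 2 % 2 = 0 := by omega
  have b1 (x : ℕ) : (4 * x + 1) / 2 % 2 = 0 := by omega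
  have b2 (x : ℕ) : (4 * x + 2) / 2 % 2 = 1 := by omega
  have b3 (x : ℕ) : (4 * x + 3) / 2 % 2 = 1 := by omega
  have c0 (x : ℕ) : 4 * x % 2 = 0 := by omega
  have c1 (x : ℕ) : (4 * x + 1) % 2 = 1 := by omega
  have c2 (x : ℕ) : (4 * x + 2) % 2 = 0 := by omega
  have c3 (x : ℕ) : (4 * x + 3) % 2 = 1 := by omega
  simp only [letterEntry, e0, e1, e2, a0, a1, a2, a3, b0, b1, b2, b3, c0, c1, c2, c3]
  rcases t with _ | t
  · rw [Finset.sum_eq_single 0 (by intro x _ hx; simp [hx]) (by simp)]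
    interval_cases s <;> interval_cases r <;> simp
  · have key : ∀ x ∈ Finset.range (d + 1), x ≠ t + 1 → x ≠ t →
        ¬ x = t + 1 ∧ ¬ t + 1 = x + 1 := by omega
    -- Only the level itself (exchange of sides) and the level below it (rise) contribute.
    rw [← Finset.sum_subset (s₁ := {t + 1, t})]
    · rw [Finset.sum_pair (by omega)]
      interval_cases s <;> interval_cases r <;> simp [colVec] <;> ring
    · intro x hx
      simp only [Finset.mem_insert, Finset.mem_singleton] at hx
      simp only [Finset.mem_range]; omega
    · intro x hx hx'
      simp only [Finset.mem_insert, Finset.mem_singleton, not_or] at hx'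
      have h2 : ¬ t + 1 = x + 1 := by omega
      have h3 : ¬ t = x := by omega
      simp [hx'.1, h3]

/-- The matrix of the letter `l` with `d + 1` levels. -/
def letterMatrix (W : ℕ → ℕ → F) (d l : ℕ) :
    Matrix (Fin (4 * (d + 1))) (Fin (4 * (d + 1))) F :=
  Matrix.of fun p q => letterEntry W l p q

/-- The square of the exchange of sides gives the identity. The two products of an exchange and a
rise cancel because inverse letters have opposite signs, and the product of two rises vanishes
because the row vector of a letter annihilates the column vector of its inverse. The cases below are
the differences 0, 1, 2 of the levels, and all others. -/
theorem letterEntry_mul (W : ℕ → ℕ → F) {d l p q : ℕ} (hq : q < 4 * (d + 1)) :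
    letterStep W d (flipCode 1 l) (letterEntry W l p) q = if p = q then 1 else 0 := by
  obtain ⟨t, s, r, hs, hr, rfl⟩ : ∃ t s r, s < 2 ∧ r < 2 ∧ q = 4 * t + 2 * s + r :=
    ⟨q / 4, q / 2 % 2, q % 2, by omega, by omega, by omega⟩
  obtain ⟨t', s', r', hs', hr', rfl⟩ : ∃ t s r, s < 2 ∧ r < 2 ∧ p = 4 * t + 2 * s + r :=
    ⟨p / 4, p / 2 % 2, p % 2, by omega, by omega, by omega⟩
  rw [letterStep_eq W _ (by omega) hs hr]
  have a (t s r : ℕ) (hs : s < 2) (hr : r < 2) : (4 * t + 2 * s + r) / 4 = t := by omega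
  have b (t s r : ℕ) (hs : s < 2) (hr : r < 2) : (4 * t + 2 * s + r) / 2 % 2 = s := by omega
  have c (t s r : ℕ) (hs : s < 2) (hr : r < 2) : (4 * t + 2 * s + r) % 2 = r := by omega
  have hs1 : 1 - s < 2 := by omega
  have hpq : 4 * t' + 2 * s' + r' = 4 * t + 2 * s + r ↔ t' = t ∧ s' = s ∧ r' = r := by omega
  rw [show 4 * (t - 1) + 2 * s = 4 * (t - 1) + 2 * s + 0 from rfl]
  simp only [letterEntry, a _ _ _ hs' hr', a _ _ _ hs1 hr, b _ _ _ hs' hr', b _ _ _ hs1 hr,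
    c _ _ _ hs' hr', c _ _ _ hs1 hr, a _ _ _ hs (by omega : 0 < 2),
    a _ _ _ hs (by omega : 1 < 2), b _ _ _ hs (by omega : 0 < 2),
    b _ _ _ hs (by omega : 1 < 2), c _ _ _ hs (by omega : 0 < 2), c _ _ _ hs (by omega : 1 < 2),
    hpq, letterSign_flipCode]
  clear a b c hs1 hpq hq
  obtain rfl | rfl | rfl | ⟨h0, h1, h2⟩ :
      t' = t ∨ t = t' + 1 ∨ t = t' + 2 ∨ (t' ≠ t ∧ t ≠ t' + 1 ∧ t ≠ t' + 2) := by omega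
  · rcases t' with _ | t'
    · interval_cases s <;> interval_cases s' <;> simp
    · have h : ¬ t' = t' + 1 + 1 := by omega
      interval_cases s <;> interval_cases s' <;> simp [h]
  -- Exchange followed by rise, and rise followed by exchange: the same block with opposite signs.
  · interval_cases s <;> interval_cases s' <;> interval_cases r' <;>
      simp [flipCode_zero, flipCode_flipCode, colVec] <;> ring
  -- Two rises: the pairing is `(l' + 1) * 1 - 1 * (l' + 1) = 0`.
  · interval_cases s <;> interval_cases s' <;>
      simp [flipCode_zero, flipCode_flipCode, rowVec]
  · rcases t with _ | t
    · simp [h0]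
    · have h3 : ¬ t' = t := by omega
      have h4 : ¬ t = t' + 1 := by omega
      have h5 : ¬ t = t' := by omega
      simp [h0, h3, h4, h5]

theorem letterMatrix_mul (W : ℕ → ℕ → F) (d l : ℕ) :
    letterMatrix W d l * letterMatrix W d (flipCode 1 l) = 1 := by
  ext p q
  rw [Matrix.mul_apply, Matrix.one_apply]
  have := letterEntry_mul W (d := d) (l := l) (p := p) q.2
  rw [letterStep, Finset.sum_range] at this
  simpa [letterMatrix, Fin.ext_iff] using this

/-- The matrices of the variables: `x_i` has the code `2 i`, its inverse the code `2 i + 1`. -/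
def letterUnit (W : ℕ → ℕ → F) (d i : ℕ) :
    (Matrix (Fin (4 * (d + 1))) (Fin (4 * (d + 1))) F)ˣ where
  val := letterMatrix W d (2 * i)
  inv := letterMatrix W d (2 * i + 1)
  val_inv := by
    have := letterMatrix_mul W d (2 * i)
    rwa [show flipCode 1 (2 * i) = 2 * i + 1 by unfold flipCode; omega] at this
  inv_val := by
    have := letterMatrix_mul W d (2 * i + 1)
    rwa [show flipCode 1 (2 * i + 1) = 2 * i by unfold flipCode; omega] at this

/-- The first row of the matrix of a word. -/
def wordVec (W : ℕ → ℕ → F) (d : ℕ) (L : List ℕ) : ℕ → F :=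
  L.foldl (fun v l => letterStep W d l v) fun q => if q = 0 then 1 else 0

@[simp] theorem wordVec_nil (W : ℕ → ℕ → F) (d : ℕ) :
    wordVec W d [] = fun q => if q = 0 then 1 else 0 := rfl

theorem wordVec_concat (W : ℕ → ℕ → F) (d : ℕ) (L : List ℕ) (l : ℕ) :
    wordVec W d (L ++ [l]) = letterStep W d l (wordVec W d L) := by
  simp [wordVec]

theorem wordVec_eq_prod (W : ℕ → ℕ → F) (d : ℕ) (L : List ℕ) (q : Fin (4 * (d + 1))) :
    wordVec W d L q = (L.map (letterMatrix W d)).prod ⟨0, by omega⟩ q := by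
  induction L using List.reverseRecOn generalizing q with
  | nil =>
    simp only [wordVec_nil, List.map_nil, List.prod_nil, Matrix.one_apply, Fin.ext_iff]
    exact if_congr eq_comm rfl rfl
  | append_singleton L l ih =>
    rw [wordVec_concat, letterStep, Finset.sum_range, List.map_append, List.prod_append,
      List.map_singleton, List.prod_singleton, Matrix.mul_apply]
    exact Finset.sum_congr rfl fun p _ => by rw [ih]; rfl

/-- A word does not lead further than its length, and on the last level only to the side `0`. -/
theorem wordVec_eq_zero (W : ℕ → ℕ → F) {d : ℕ} (L : List ℕ) {t s r : ℕ} (ht : t ≤ d)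
    (hs : s < 2) (hr : r < 2) (h : L.length < t ∨ L.length = t ∧ s = 1) :
    wordVec W d L (4 * t + 2 * s + r) = 0 := by
  induction L using List.reverseRecOn generalizing t s r with
  | nil =>
    have : ¬ 4 * t + 2 * s + r = 0 := by simp at h; omega
    rw [wordVec_nil]
    exact if_neg this
  | append_singleton L l ih =>
    rw [List.length_append, List.length_singleton] at h
    rw [wordVec_concat, letterStep_eq W _ ht hs hr, ih ht (by omega) hr (by omega),
      if_neg (by omega)]
    have h0 := ih (t := t - 1) (s := s) (r := 0) (by omega) hs (by omega) (by omega)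
    have h1 := ih (t := t - 1) (s := s) (r := 1) (by omega) hs (by omega) (by omega)
    rw [add_zero] at h0
    rw [h0, h1]
    ring

theorem wordVec_eq_zero_of_length_lt (W : ℕ → ℕ → F) {d K : ℕ} (L : List ℕ) (hK : K ≤ d)
    (h : L.length < K) : wordVec W d L (4 * K) = 0 :=
  wordVec_eq_zero W L (s := 0) (r := 0) hK (by omega) (by omega) (Or.inl h)

/-- On reduced words of length `K`, the entry on the level `K` is a product of weights times a
nonzero constant. -/
theorem exists_wordVec_eq [CharZero F] {L : List ℕ}
    (hL : L.IsChain fun a b => b ≠ flipCode 1 a) :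
    ∃ c : F, c ≠ 0 ∧ ∀ (W : ℕ → ℕ → F) (d : ℕ), L.length ≤ d →
      wordVec W d L (4 * L.length) = c * ∏ t ∈ Finset.range L.length, W t (L.getD t 0) := by
  -- The induction needs both coordinates on the level reached, since the next letter pairs them
  -- with its column vector. Together they form a multiple of the row vector of the last letter,
  -- which is split off as `l`.
  suffices H : ∀ (L : List ℕ) (l : ℕ), (L ++ [l]).IsChain (fun a b => b ≠ flipCode 1 a) →
      ∃ c : F, c ≠ 0 ∧ ∀ (W : ℕ → ℕ → F) (d : ℕ), L.length + 1 ≤ d → ∀ r < 2,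
        wordVec W d (L ++ [l]) (4 * (L.length + 1) + 2 * 0 + r) =
          c * (∏ t ∈ Finset.range (L.length + 1), W t ((L ++ [l]).getD t 0)) * rowVec l r by
    rcases List.eq_nil_or_concat L with rfl | ⟨L, l, rfl⟩
    · exact ⟨1, one_ne_zero, by simp⟩
    · rw [List.concat_eq_append] at *
      obtain ⟨c, hc, h⟩ := H L l hL
      refine ⟨c * (flipCode 1 l + 1 : ℕ), mul_ne_zero hc (Nat.cast_ne_zero.2 (Nat.succ_ne_zero _)),
        fun W d hd => ?_⟩
      rw [List.length_append, List.length_singleton] at hd ⊢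
      have := h W d hd 0 (by omega)
      simp only [Nat.add_zero, Nat.mul_zero] at this
      rw [this]
      simp only [rowVec, if_true]
      ring
  intro L
  induction L using List.reverseRecOn with
  | nil =>
    intro l _
    refine ⟨letterSign l, by unfold letterSign; split <;> simp, fun W d hd r hr => ?_⟩
    rw [wordVec_concat, letterStep_eq W _ hd (by omega) hr]
    simp [flipCode_zero]
  | append_singleton L m ih =>
    intro l hl
    obtain ⟨c, hc, h⟩ := ih m (List.IsChain.left_of_append hl)
    have hml : l ≠ flipCode 1 m := by
      rw [List.append_assoc, List.isChain_append] at hl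
      simpa using hl.2.1
    -- This is the pairing of the row vector of `m` with the column vector of `l`. It is nonzero
    -- because `l` is not the inverse of `m` and codes remain distinct in characteristic zero.
    have hml' : ((flipCode 1 m + 1 : ℕ) : F) - (l + 1 : ℕ) ≠ 0 := by
      rw [sub_ne_zero]
      intro e
      have := Nat.cast_injective e
      omega
    refine ⟨c * (((flipCode 1 m + 1 : ℕ) : F) - (l + 1 : ℕ)) * letterSign l,
      mul_ne_zero (mul_ne_zero hc hml') (by unfold letterSign; split <;> simp),
      fun W d hd r hr => ?_⟩
    rw [List.length_append, List.length_singleton] at *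
    rw [wordVec_concat, letterStep_eq W _ hd (by omega) hr, if_neg (by omega),
      wordVec_eq_zero W _ hd (by omega) hr (Or.inl (by simp))]
    have h0 := h W d (by omega) 0 (by omega)
    have h1 := h W d (by omega) 1 (by omega)
    simp only [Nat.add_zero, Nat.mul_zero] at h0 h1
    rw [Nat.add_sub_cancel, Nat.mul_zero, Nat.add_zero, h0, h1,
      Finset.prod_range_succ _ (L.length + 1)]
    have hp : ∏ t ∈ Finset.range (L.length + 1), W t ((L ++ [m] ++ [l]).getD t 0) =
        ∏ t ∈ Finset.range (L.length + 1), W t ((L ++ [m]).getD t 0) := by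
      refine Finset.prod_congr rfl fun t ht => ?_
      rw [List.getD_append]
      simpa using ht
    have hlast : (L ++ [m] ++ [l]).getD (L.length + 1) 0 = l := by
      rw [List.getD_append_right] <;> simp
    rw [hp, hlast, flipCode_zero]
    simp only [rowVec, if_true, one_ne_zero, if_false]
    ring

end Representation

/-! ### Codes of reduced words and the prefix test -/

section FreeGroup

variable {F : Type*} [Field F] {n : ℕ}

/-- The codes of the letters of the reduced word of `w`. -/
def wordCodes (w : FreeGroup (Fin n)) : List ℕ := w.toWord.map letterCode

theorem letterCode_injective : Function.Injective (letterCode (n := n)) := by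
  rintro ⟨i, b⟩ ⟨j, c⟩ h
  have h' : 2 * (i : ℕ) + (if b then 0 else 1) = 2 * (j : ℕ) + (if c then 0 else 1) := h
  cases b <;> cases c <;> simp [Fin.ext_iff] at * <;> omega

theorem letterCode_lt (l : Fin n × Bool) : letterCode l < 2 * n := by
  have := l.1.2
  unfold letterCode
  split <;> omega

theorem wordCodes_injective : Function.Injective (wordCodes (n := n)) :=
  (letterCode_injective.list_map).comp FreeGroup.toWord_injective

theorem length_wordCodes (w : FreeGroup (Fin n)) : (wordCodes w).length = w.norm := by
  simp [wordCodes, FreeGroup.norm]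

theorem lt_of_mem_wordCodes {w : FreeGroup (Fin n)} {l : ℕ} (h : l ∈ wordCodes w) : l < 2 * n := by
  obtain ⟨x, _, rfl⟩ := List.mem_map.1 h
  exact letterCode_lt x

theorem isChain_wordCodes (w : FreeGroup (Fin n)) :
    (wordCodes w).IsChain fun a b => b ≠ flipCode 1 a := by
  rw [wordCodes, List.isChain_map]
  refine (FreeGroup.isReduced_toWord (x := w)).imp ?_
  rintro ⟨i, b⟩ ⟨j, c⟩ h e
  simp only [letterCode, flipCode] at e h
  have hij : i = j := by
    apply Fin.ext
    cases b <;> cases c <;> simp at e <;> omega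
  have := h hij
  subst this
  cases b <;> simp at e <;> omega

theorem lift_letterUnit (W : ℕ → ℕ → F) (d : ℕ) (w : FreeGroup (Fin n)) :
    ((FreeGroup.lift (fun i : Fin n => letterUnit W d i) w : _ˣ) :
      Matrix (Fin (4 * (d + 1))) (Fin (4 * (d + 1))) F) =
      ((wordCodes w).map (letterMatrix W d)).prod := by
  conv_lhs => rw [← FreeGroup.mk_toWord (x := w), FreeGroup.lift_mk]
  rw [wordCodes, List.map_map, ← Units.coeHom_apply, map_list_prod, List.map_map]
  congr 2
  funext ⟨i, b⟩
  cases b <;> simp [letterCode, letterUnit]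

theorem evalMatrix_letterUnit (W : ℕ → ℕ → F) (d : ℕ) (f : FreeGroupAlgebra F n)
    (q : Fin (4 * (d + 1))) :
    f.evalMatrix (4 * (d + 1)) (fun i => letterUnit W d i) ⟨0, by omega⟩ q =
      ∑ w ∈ f.coeff.support, f.coeff w * wordVec W d (wordCodes w) q := by
  rw [FreeGroupAlgebra.evalMatrix, MonoidAlgebra.lift_apply, Finsupp.sum, Matrix.sum_apply]
  refine Finset.sum_congr rfl fun w _ => ?_
  rw [wordVec_eq_prod, Matrix.smul_apply, smul_eq_mul, ← lift_letterUnit]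
  rfl

/-- Reduction modulo `N` compares the lowest digits; cancelling them and dividing by `N` leaves a
shorter expansion. -/
theorem eq_of_sum_mul_pow_eq {N K : ℕ} {a b : ℕ → ℕ} (ha : ∀ t < K, a t < N)
    (hb : ∀ t < K, b t < N)
    (h : ∑ t ∈ Finset.range K, a t * N ^ t = ∑ t ∈ Finset.range K, b t * N ^ t) :
    ∀ t < K, a t = b t := by
  induction K generalizing a b with
  | zero => intro t ht; omega
  | succ K ih =>
    have hN : 0 < N := lt_of_le_of_lt (Nat.zero_le _) (ha 0 (by omega))
    have split (c : ℕ → ℕ) : ∑ t ∈ Finset.range (K + 1), c t * N ^ t =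
        N * ∑ t ∈ Finset.range K, c (t + 1) * N ^ t + c 0 := by
      rw [Finset.sum_range_succ', Finset.mul_sum]
      simp only [pow_zero, mul_one, add_left_inj]
      exact Finset.sum_congr rfl fun t _ => by ring
    rw [split, split] at h
    have h0 : a 0 = b 0 := by
      have := congrArg (· % N) h
      simpa [Nat.mul_add_mod, Nat.mod_eq_of_lt (ha 0 (by omega)),
        Nat.mod_eq_of_lt (hb 0 (by omega))] using this
    rw [h0, add_left_inj] at h
    have h1 := ih (a := fun t => a (t + 1)) (b := fun t => b (t + 1))
      (fun t ht => ha _ (by omega)) (fun t ht => hb _ (by omega)) (Nat.eq_of_mul_eq_mul_left hN h)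
    rintro (_ | t) ht
    · exact h0
    · exact h1 t (by omega)

/-- The Vandermonde matrix of the distinct values of `z` on `T` is invertible, and its exponents are
among those below `s`. -/
theorem eq_zero_of_sum_mul_pow_eq_zero {ι : Type*} {T : Finset ι} {b z : ι → F} {s : ℕ}
    (hT : T.card ≤ s) (hz : Set.InjOn z T) (h : ∀ k < s, ∑ w ∈ T, b w * z w ^ k = 0) :
    ∀ w ∈ T, b w = 0 := by
  have key := Matrix.eq_zero_of_forall_pow_sum_mul_pow_eq_zero
    (f := fun i => z (T.equivFin.symm i)) (v := fun i => b (T.equivFin.symm i))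
    (fun i j hij => T.equivFin.symm.injective (Subtype.ext (hz (Subtype.coe_prop _)
      (Subtype.coe_prop _) hij)))
    (fun k => by
      have := h k (by omega)
      rw [← Finset.sum_coe_sort] at this
      rw [← this]
      exact Equiv.sum_comp T.equivFin.symm fun w : T => b w * z w ^ (k : ℕ))
  intro w hw
  simpa using congrFun key (T.equivFin ⟨w, hw⟩)

/-- Weights that select the prefix of length `m` of `u` and take the `k`-th powers of generic
weights on the other levels. -/
def testWeight (N : ℕ) (u : ℕ → ℕ) (m k t l : ℕ) : F :=
  if t < m then if l = u t then 1 else 0 else (2 ^ N ^ t) ^ (l * k)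

/-- The exponents of 2 add up to `k` times a number whose digits in base `N` are the letters; levels
of the prefix have the weight 1 and contribute the digit 0. -/
theorem prod_testWeight (N : ℕ) (u : ℕ → ℕ) (m k K : ℕ) (L : ℕ → ℕ) (hm : m ≤ K) :
    ∏ t ∈ Finset.range K, testWeight (F := F) N u m k t (L t) =
      if ∀ t < m, L t = u t then
        (2 ^ ∑ t ∈ Finset.range K, (if t < m then 0 else L t) * N ^ t) ^ k else 0 := by
  split
  case isTrue h =>
    rw [← Finset.prod_pow_eq_pow_sum, ← Finset.prod_pow]
    refine Finset.prod_congr rfl fun t _ => ?_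
    unfold testWeight
    by_cases ht : t < m
    · simp [ht, h t ht]
    · simp only [ht, if_false]
      rw [← pow_mul, ← pow_mul]
      ring
  case isFalse h =>
    push Not at h
    obtain ⟨t, ht, hne⟩ := h
    exact Finset.prod_eq_zero (Finset.mem_range.2 (ht.trans_le hm)) (by simp [testWeight, ht, hne])

variable [CharZero F]

/-- The value of a word under the weights `testWeight`. -/
theorem exists_wordVec_testWeight (w : FreeGroup (Fin n)) :
    ∃ c : F, c ≠ 0 ∧ ∀ (u : ℕ → ℕ) (m k d : ℕ), m ≤ w.norm → w.norm ≤ d →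
      wordVec (testWeight (2 * n) u m k) d (wordCodes w) (4 * w.norm) =
        if ∀ t < m, (wordCodes w).getD t 0 = u t then
          c * (2 ^ ∑ t ∈ Finset.range w.norm,
            (if t < m then 0 else (wordCodes w).getD t 0) * (2 * n) ^ t) ^ k else 0 := by
  obtain ⟨c, hc, h⟩ := exists_wordVec_eq (F := F) (isChain_wordCodes w)
  refine ⟨c, hc, fun u m k d hm hd => ?_⟩
  have := h (testWeight (2 * n) u m k) d (by rwa [length_wordCodes])
  rw [length_wordCodes] at this
  rw [this, prod_testWeight _ _ _ _ _ _ hm]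
  split <;> simp

theorem getD_wordCodes_lt {w : FreeGroup (Fin n)} {t : ℕ} (h : t < w.norm) :
    (wordCodes w).getD t 0 < 2 * n := by
  rw [← length_wordCodes] at h
  rw [List.getD_eq_getElem _ _ h]
  exact lt_of_mem_wordCodes (List.getElem_mem h)

theorem eq_of_getD_wordCodes {w w' : FreeGroup (Fin n)} (hn : w.norm = w'.norm)
    (h : ∀ t < w.norm, (wordCodes w).getD t 0 = (wordCodes w').getD t 0) : w = w' := by
  apply wordCodes_injective
  apply List.ext_getElem
  · rw [length_wordCodes, length_wordCodes, hn]
  · intro t h1 h2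
    have := h t (by rwa [← length_wordCodes])
    rwa [List.getD_eq_getElem _ _ h1, List.getD_eq_getElem _ _ h2] at this

/-- The value of a linear combination of words under the weights `testWeight`. -/
noncomputable def testValue (d K : ℕ) (S : Finset (FreeGroup (Fin n))) (a : FreeGroup (Fin n) → F)
    (u : ℕ → ℕ) (m k : ℕ) : F :=
  ∑ w ∈ S, a w * wordVec (testWeight (2 * n) u m k) d (wordCodes w) (4 * K)

/-- The test for the existence of a word of maximal length with a given prefix. -/
theorem exists_testValue_ne_zero_iff {d K s m : ℕ} {S : Finset (FreeGroup (Fin n))}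
    {a : FreeGroup (Fin n) → F} (u : ℕ → ℕ) (hS : S.card ≤ s) (ha : ∀ w ∈ S, a w ≠ 0)
    (hK : ∀ w ∈ S, w.norm ≤ K) (hd : K ≤ d) (hm : m ≤ K) :
    (∃ k < s, testValue d K S a u m k ≠ 0) ↔
      ∃ w ∈ S, w.norm = K ∧ ∀ t < m, (wordCodes w).getD t 0 = u t := by
  classical
  choose c hc hval using exists_wordVec_testWeight (F := F) (n := n)
  set T := S.filter fun w => w.norm = K ∧ ∀ t < m, (wordCodes w).getD t 0 = u t with hT
  set E : FreeGroup (Fin n) → ℕ := fun w => ∑ t ∈ Finset.range K,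
    (if t < m then 0 else (wordCodes w).getD t 0) * (2 * n) ^ t with hE
  -- Words shorter than `K` do not reach the level `K`, and words of length `K` with another prefix
  -- meet a weight 0. What remains is a power sum over `T` with nonzero coefficients.
  have hsum (k : ℕ) : testValue d K S a u m k = ∑ w ∈ T, (a w * c w) * ((2 : F) ^ E w) ^ k := by
    rw [hT, Finset.sum_filter, testValue]
    refine Finset.sum_congr rfl fun w hw => ?_
    rcases (hK w hw).lt_or_eq with hlt | heq
    · rw [wordVec_eq_zero_of_length_lt _ _ hd (by rwa [length_wordCodes]), if_neg (by omega),
        mul_zero]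
    · subst heq
      rw [hval w u m k d hm hd]
      by_cases hp : ∀ t < m, (wordCodes w).getD t 0 = u t
      · rw [if_pos hp, if_pos ⟨rfl, hp⟩, mul_assoc]
      · rw [if_neg hp, if_neg (fun h => hp h.2), mul_zero]
  -- Powers of 2 determine their exponents in characteristic zero, and the exponents determine the
  -- letters beyond the prefix as digits. The letters of the prefix, suppressed in `E`, are common
  -- to all of `T`.
  have hinj : Set.InjOn (fun w => (2 : F) ^ E w) T := by
    intro w hw w' hw' h
    simp only [hT, Finset.coe_filter, Set.mem_ofPred_eq] at hw hw'
    have hEE : E w = E w' := by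
      have h' : ((2 ^ E w : ℕ) : F) = ((2 ^ E w' : ℕ) : F) := by push_cast; exact h
      exact Nat.pow_right_injective le_rfl (Nat.cast_injective h')
    refine eq_of_getD_wordCodes (hw.2.1.trans hw'.2.1.symm) fun t ht => ?_
    by_cases htm : t < m
    · rw [hw.2.2 t htm, hw'.2.2 t htm]
    · have key := eq_of_sum_mul_pow_eq (N := 2 * n) (K := K)
        (a := fun t => if t < m then 0 else (wordCodes w).getD t 0)
        (b := fun t => if t < m then 0 else (wordCodes w').getD t 0) ?_ ?_ hEE t (by omega)
      · simpa [htm] using key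
      · intro t ht
        have := getD_wordCodes_lt (w := w) (t := t) (by omega)
        split <;> omega
      · intro t ht
        have := getD_wordCodes_lt (w := w') (t := t) (by omega)
        split <;> omega
  constructor
  · rintro ⟨k, _, hk⟩
    rw [hsum] at hk
    obtain ⟨w, hw, _⟩ := Finset.exists_ne_zero_of_sum_ne_zero hk
    rw [hT, Finset.mem_filter] at hw
    exact ⟨w, hw⟩
  · rintro ⟨w, hw, hw'⟩
    by_contra! hcon
    have := eq_zero_of_sum_mul_pow_eq_zero (b := fun w => a w * c w) (z := fun w => (2 : F) ^ E w)
      ((Finset.card_filter_le _ _).trans hS) hinj (fun k hk => by rw [← hsum]; exact hcon k hk) w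
      (Finset.mem_filter.2 ⟨hw, hw'⟩)
    exact mul_ne_zero (ha w hw) (hc w) this

/-- With `m = K` the whole word is prescribed, so the value can be nonzero only if this very word
occurs. A failed search therefore cannot produce a spurious term. -/
theorem testValue_eq_zero {d K k : ℕ} {S : Finset (FreeGroup (Fin n))}
    {a : FreeGroup (Fin n) → F} (u : ℕ → ℕ) (hK : ∀ w ∈ S, w.norm ≤ K) (hd : K ≤ d)
    (h : ¬ ∃ w ∈ S, w.norm = K ∧ ∀ t < K, (wordCodes w).getD t 0 = u t) :
    testValue d K S a u K k = 0 := by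
  refine Finset.sum_eq_zero fun w hw => ?_
  rcases (hK w hw).lt_or_eq with hlt | heq
  · rw [wordVec_eq_zero_of_length_lt _ _ hd (by rwa [length_wordCodes]), mul_zero]
  · subst heq
    obtain ⟨c, _, hval⟩ := exists_wordVec_testWeight (F := F) w
    rw [hval u _ k d le_rfl hd, if_neg (fun hp => h ⟨w, hw, rfl, hp⟩), mul_zero]

/-- When the whole word is prescribed, a single summand survives; dividing by the value of the word
returns its coefficient. -/
theorem testValue_eq {d K k : ℕ} {S : Finset (FreeGroup (Fin n))}
    {a : FreeGroup (Fin n) → F} (u : ℕ → ℕ) (hK : ∀ w ∈ S, w.norm ≤ K) (hd : K ≤ d)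
    {w : FreeGroup (Fin n)} (hw : w ∈ S) (hwK : w.norm = K)
    (hu : ∀ t < K, (wordCodes w).getD t 0 = u t) :
    wordVec (testWeight (F := F) (2 * n) u K k) d (wordCodes w) (4 * K) ≠ 0 ∧
      testValue d K S a u K k =
        a w * wordVec (testWeight (2 * n) u K k) d (wordCodes w) (4 * K) := by
  constructor
  · subst hwK
    obtain ⟨c, hc, hval⟩ := exists_wordVec_testWeight (F := F) w
    rw [hval u _ k d le_rfl hd, if_pos hu]
    exact mul_ne_zero hc (pow_ne_zero _ (pow_ne_zero _ two_ne_zero))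
  · refine Finset.sum_eq_single w (fun w' hw' hne => ?_) (fun h => absurd hw h)
    rcases (hK w' hw').lt_or_eq with hlt | heq
    · rw [wordVec_eq_zero_of_length_lt _ _ hd (by rwa [length_wordCodes]), mul_zero]
    · subst heq
      obtain ⟨c, _, hval⟩ := exists_wordVec_testWeight (F := F) w'
      rw [hval u _ k d le_rfl hd, if_neg, mul_zero]
      exact fun hp => hne (eq_of_getD_wordCodes hwK.symm fun t ht => by rw [hp t ht, hu t ht])

end FreeGroup

end AlgRAM

/-! ### Rules for reasoning about executions -/

namespace AlgRAM

/-- The algorithm uses only the first row of an answer, and this row occupies the first `k` cells.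
-/
theorem writeMatrix_fld_zero {F : Type*} (σ : State F) {a k j : ℕ}
    (R : Matrix (Fin k) (Fin k) F) (hj : j < k) :
    (σ.writeMatrix a k R).fld a j = R ⟨0, by omega⟩ ⟨j, hj⟩ := by
  have hjk : j < k * k := lt_of_lt_of_le hj (Nat.le_mul_of_pos_left k (by omega))
  have : finProdFinEquiv.symm ⟨j, hjk⟩ = ((⟨0, by omega⟩, ⟨j, hj⟩) : Fin k × Fin k) := by
    rw [Equiv.symm_apply_eq]
    ext
    simp [finProdFinEquiv]
  simp only [State.writeMatrix, true_and, hjk, dite_true, this]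

section Rules

variable {F : Type*} [Field F] {n : ℕ} (O : Oracle F n)

theorem exec_setNat (a : ℕ) (i e : NExp) (σ : State F) :
    (Cmd.setNat a i e).exec O σ = σ.setNat a (i.eval σ) (e.eval σ) := rfl

theorem exec_setFld (a : ℕ) (i : NExp) (e : FExp) (σ : State F) :
    (Cmd.setFld a i e).exec O σ = σ.setFld a (i.eval σ) (e.eval σ) := rfl

theorem exec_seq (P Q : Cmd) (σ : State F) :
    (Cmd.seq P Q).exec O σ = Q.exec O (P.exec O σ) := rfl

theorem exec_skip (σ : State F) : Cmd.skip.exec O σ = σ := rfl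

open Classical in
theorem exec_ite (c : Test) (P Q : Cmd) (σ : State F) :
    (Cmd.ite c P Q).exec O σ = if c.holds σ then P.exec O σ else Q.exec O σ := rfl

/-- Invariants of loops. -/
theorem exec_loop {v r : ℕ} {P : Cmd} {σ : State F} (I : ℕ → State F → Prop)
    (h0 : I 0 (σ.setNat v 0 0))
    (hs : ∀ i < σ.nat r 0, ∀ τ : State F, τ.nat v 0 = i →
      (∀ a, a ∉ v :: P.nats → τ.nat a = σ.nat a) → (∀ a, a ∉ P.flds → τ.fld a = σ.fld a) →
      I i τ → I (i + 1) ((P.exec O τ).setNat v 0 (i + 1))) :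
    I (σ.nat r 0) ((Cmd.loop v r P).exec O σ) := by
  have key : ∀ i ≤ σ.nat r 0, I i (loopState (P.exec O) v σ i) ∧
      (∀ a, a ∉ v :: P.nats → (loopState (P.exec O) v σ i).nat a = σ.nat a) ∧
      (∀ a, a ∉ P.flds → (loopState (P.exec O) v σ i).fld a = σ.fld a) := by
    intro i hi
    induction i with
    | zero =>
      refine ⟨h0, fun a ha => State.setNat_nat_of_ne _ ?_, fun a _ => rfl⟩
      simp only [List.mem_cons, not_or] at ha
      exact ha.1
    | succ i ih =>
      obtain ⟨h1, h2, h3⟩ := ih (by omega)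
      refine ⟨hs i (by omega) _ (loopState_self _ _ _ _) h2 h3 h1, fun a ha => ?_, fun a ha => ?_⟩
      · have ha' := ha
        simp only [List.mem_cons, not_or] at ha'
        rw [loopState, State.setNat_nat_of_ne _ ha'.1, Cmd.exec_nat O P _ ha'.2, h2 a ha]
      · rw [loopState, State.setNat_fld, Cmd.exec_fld O P _ ha, h3 a ha]
  exact (key _ le_rfl).1

/-- A loop that fills an array. -/
theorem exec_loop_fill {v r b : ℕ} {P : Cmd} {σ : State F} (g : ℕ → F)
    (hs : ∀ i < σ.nat r 0, ∀ τ : State F, τ.nat v 0 = i →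
      (∀ a, a ∉ v :: P.nats → τ.nat a = σ.nat a) → (∀ a, a ∉ P.flds → τ.fld a = σ.fld a) →
      (∀ j < i, τ.fld b j = g j) → ∀ j ≤ i, (P.exec O τ).fld b j = g j) :
    ∀ j < σ.nat r 0, ((Cmd.loop v r P).exec O σ).fld b j = g j := by
  refine exec_loop O (fun i τ => ∀ j < i, τ.fld b j = g j) (by simp) ?_
  intro i hi τ h1 h2 h3 h4 j hj
  exact hs i hi τ h1 h2 h3 h4 j (by omega)

/-- A unit is determined by its underlying matrix, so the tuple chosen in `Cmd.exec` must be the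
given one. -/
theorem exec_query {k a b m : ℕ} {σ : State F} (hk : σ.nat k 0 = m)
    (A : Fin n → (Matrix (Fin m) (Fin m) F)ˣ)
    (hA : ∀ i : Fin n, (A i : Matrix (Fin m) (Fin m) F) = σ.readMatrix a m i) :
    (Cmd.query k a b).Safe O σ ∧ (Cmd.query k a b).exec O σ = σ.writeMatrix b m (O m A) := by
  subst hk
  have hs : ∃ A : Fin n → (Matrix (Fin (σ.nat k 0)) (Fin (σ.nat k 0)) F)ˣ,
      ∀ i : Fin n, (A i : Matrix _ _ F) = σ.readMatrix a (σ.nat k 0) i := ⟨A, hA⟩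
  refine ⟨hs, ?_⟩
  have : hs.choose = A := funext fun i => Units.ext ((hs.choose_spec i).trans (hA i).symm)
  simp only [Cmd.exec, dif_pos hs, this]

end Rules

section QueryFree

/-- The program makes no queries. -/
def Cmd.queryFree : Cmd → Bool
  | seq P Q => P.queryFree && Q.queryFree
  | ite _ P Q => P.queryFree && Q.queryFree
  | loop _ _ P => P.queryFree
  | query _ _ _ => false
  | _ => true

variable {F : Type*} [Field F] {n : ℕ} (O : Oracle F n)

theorem Cmd.safe_of_queryFree :
    ∀ (P : Cmd) (σ : State F), P.queryFree = true → P.Safe O σ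
  | setNat _ _ _, _, _ => trivial
  | setFld _ _ _, _, _ => trivial
  | seq P Q, σ, h => by
    simp only [queryFree, Bool.and_eq_true] at h
    exact ⟨safe_of_queryFree P _ h.1, safe_of_queryFree Q _ h.2⟩
  | ite c P Q, σ, h => by
    simp only [queryFree, Bool.and_eq_true] at h
    exact ⟨fun _ => safe_of_queryFree P _ h.1, fun _ => safe_of_queryFree Q _ h.2⟩
  | loop v r P, σ, h => fun i _ => safe_of_queryFree P _ h
  | skip, _, _ => trivial

end QueryFree

/-! ### The part of the program that evaluates the black box and the known terms -/

section Program

/-!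
Memory of the program.  Arrays of natural numbers: `0` input, `1` number of terms, `2` lengths,
`3` words; registers: `4` `d`, `5` `s`, `6` `s + 1`, `7` `2 n`, `8` dimension of the matrices,
`9` number of entries of the matrices, `10` number of weights, `11` `d + 1`, `21` current length
`K`, `35` success flag, `36` position of the current word, `37` length of the prefix; `20` and
`22` to `34` loop variables, `25` being the exponent in the test.
Field arrays: `0` coefficients, `1` indicator of zero, `2` numbers, `3` generic weights,
`4` weights, `5` matrices, `6` answer, `7` row vector, `8` new row vector; registers: `9` value,
`10` value of the current word, `11` auxiliary.
-/

/-- `1` for equal arguments, otherwise `0`. -/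
def FExp.ind (x y : NExp) : FExp := .get 1 (.add (.sub x y) (.sub y x))

def NExp.flip (s l : NExp) : NExp :=
  .sub (.add l s) (.mul (.const 2) (.mul s (.mod l (.const 2))))

def NExp.level (p : NExp) : NExp := .div p (.const 4)

def NExp.side (p : NExp) : NExp := .mod (.div p (.const 2)) (.const 2)

def NExp.bit (p : NExp) : NExp := .mod p (.const 2)

/-- The expression for `letterEntry`. -/
def FExp.entry (l p q : NExp) : FExp :=
  -- Field expressions have no case distinction; every condition is a factor read from the table of
  -- indicators, which also annihilates whatever is read from cells outside the tables.
  .add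
    (.mul (.mul (.ind p.level q.level)
      (.ind (.add (.sub p.side q.side) (.sub q.side p.side)) (.const 1))) (.ind p.bit q.bit))
    (.mul (.mul (.ind q.level (.add p.level (.const 1))) (.ind p.side q.side))
      (.mul (.mul (.mul (.sub (.ind l.bit (.const 0)) (.ind l.bit (.const 1)))
        (.get 4 (.add (.mul p.level (.reg 7)) (.flip p.side l))))
        (.get 2 (.add (.const 1) (.mul p.bit (.flip p.side l)))))
        (.sub (.mul (.ind q.bit (.const 0))
          (.get 2 (.add (.flip (.const 1) (.flip p.side l)) (.const 1)))) (.get 2 q.bit))))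

/-- Powers of the generic weights. -/
def powerCmd : Cmd :=
  -- Loops must be bounded by protected registers, so these run to `2 n` and `s`, while the tests
  -- make only the first l, respectively k, rounds effective: l k multiplications in all.
  .loop 27 7 (.ite (.natLt (.reg 27) (.mod (.reg 26) (.reg 7)))
    (.loop 28 5 (.ite (.natLt (.reg 28) (.reg 25))
      (.setFld 11 (.const 0) (.mul (.reg 11) (.get 3 (.div (.reg 26) (.reg 7))))) .skip)) .skip)

/-- The table of the weights `testWeight`. -/
def weightCmd : Cmd :=
  .loop 26 10 (.seq
    (.seq (.setFld 11 (.const 0) .one)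
      (.ite (.natLt (.div (.reg 26) (.reg 7)) (.reg 37))
        (.ite (.natEq (.mod (.reg 26) (.reg 7))
            (.get 3 (.add (.reg 36) (.div (.reg 26) (.reg 7)))))
          .skip (.setFld 11 (.const 0) .zero))
        powerCmd))
    (.setFld 4 (.reg 26) (.reg 11)))

/-- The matrices for the query. -/
def matrixCmd : Cmd :=
  .loop 29 9 (.setFld 5 (.reg 29)
    (.entry (.mul (.const 2) (.div (.div (.reg 29) (.reg 8)) (.reg 8)))
      (.mod (.div (.reg 29) (.reg 8)) (.reg 8)) (.mod (.reg 29) (.reg 8))))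

/-- The row vector times the matrix of the letter in the register `32`. -/
def stepCmd : Cmd :=
  .seq
    (.loop 33 8 (.seq (.setFld 8 (.reg 33) .zero)
      (.loop 34 8 (.setFld 8 (.reg 33) (.add (.get 8 (.reg 33))
        (.mul (.get 7 (.reg 34)) (.entry (.reg 32) (.reg 34) (.reg 33))))))))
    (.loop 33 8 (.setFld 7 (.reg 33) (.get 8 (.reg 33))))

/-- The first row of the matrix of the word with the number in the register `30`. -/
def wordCmd : Cmd :=
  .seq
    (.loop 33 8 (.setFld 7 (.reg 33) (.get 1 (.reg 33))))
    (.loop 31 4 (.ite (.natLt (.reg 31) (.get 2 (.reg 30)))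
      (.loop 32 7 (.ite
        (.natEq (.reg 32) (.get 3 (.add (.mul (.reg 30) (.reg 4)) (.reg 31)))) stepCmd .skip))
      .skip))

/-- The entry on the level `K`. -/
def NExp.target : NExp := .add (.add (.reg 21) (.reg 21)) (.add (.reg 21) (.reg 21))

/-- Subtraction of the known terms. -/
def subtractCmd : Cmd :=
  -- The bound is `s + 1` and not `s`: after the known terms one more round evaluates the candidate
  -- word stored behind them, and its value goes to the register 10.
  .loop 30 6 (.ite (.natLt (.reg 1) (.reg 30)) .skip
    (.seq wordCmd (.ite (.natLt (.reg 30) (.reg 1))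
      (.setFld 9 (.const 0) (.sub (.reg 9) (.mul (.get 0 (.reg 30)) (.get 7 .target))))
      (.setFld 10 (.const 0) (.get 7 .target)))))

/-- The query at the matrices for the weights. -/
def queryCmd : Cmd := .seq weightCmd (.seq matrixCmd (.query 8 5 6))

/-- The value `testValue` of the remaining terms. -/
def valueCmd : Cmd :=
  .seq queryCmd (.seq (.setFld 9 (.const 0) (.get 6 .target)) subtractCmd)

/-- The loop variables and bounds that the main program may use. -/
def constRegs : List ℕ := [0, 4, 5, 6, 7, 8, 9, 10, 11]

end Program

/-! ### Correctness of the evaluation -/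

section Specification

variable {F : Type*} [Field F] {n : ℕ}

/-- The registers and tables that do not change. -/
structure Context (n d s : ℕ) (σ : State F) : Prop where
  rank : σ.nat 0 0 = n
  degree : σ.nat 4 0 = d
  sparsity : σ.nat 5 0 = s
  terms : σ.nat 6 0 = s + 1
  letters : σ.nat 7 0 = 2 * n
  dim : σ.nat 8 0 = 4 * (d + 1)
  entries : σ.nat 9 0 = n * (4 * (d + 1)) * (4 * (d + 1))
  weights : σ.nat 10 0 = d * (2 * n)
  levels : σ.nat 11 0 = d + 1
  ind : ∀ i, σ.fld 1 i = if i = 0 then 1 else 0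
  cast : ∀ i ≤ 2 * n, σ.fld 2 i = (i : F)
  generic : ∀ t ≤ d, σ.fld 3 t = 2 ^ (2 * n) ^ t

variable {d s : ℕ} {σ : State F}

theorem Context.of_eq (h : Context n d s σ) {τ : State F}
    (hn : ∀ a ∈ constRegs, τ.nat a = σ.nat a) (hf : ∀ a ∈ [1, 2, 3], τ.fld a = σ.fld a) :
    Context n d s τ where
  rank := by rw [hn 0 (by decide)]; exact h.rank
  degree := by rw [hn 4 (by decide)]; exact h.degree
  sparsity := by rw [hn 5 (by decide)]; exact h.sparsity
  terms := by rw [hn 6 (by decide)]; exact h.terms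
  letters := by rw [hn 7 (by decide)]; exact h.letters
  dim := by rw [hn 8 (by decide)]; exact h.dim
  entries := by rw [hn 9 (by decide)]; exact h.entries
  weights := by rw [hn 10 (by decide)]; exact h.weights
  levels := by rw [hn 11 (by decide)]; exact h.levels
  ind := by rw [hf 1 (by decide)]; exact h.ind
  cast := by rw [hf 2 (by decide)]; exact h.cast
  generic := by rw [hf 3 (by decide)]; exact h.generic

/-- Inside a loop only the listed arrays can have changed. For concrete programs these lists are
explicit, so `decide` checks that the context is not among them. -/
theorem Context.of_frame (h : Context n d s σ) {τ : State F} {N M : List ℕ}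
    (hn : ∀ a, a ∉ N → τ.nat a = σ.nat a) (hf : ∀ a, a ∉ M → τ.fld a = σ.fld a)
    (hN : ∀ a ∈ constRegs, a ∉ N) (hM : ∀ a ∈ [1, 2, 3], a ∉ M) : Context n d s τ :=
  h.of_eq (fun a ha => hn a (hN a ha)) (fun a ha => hf a (hM a ha))

theorem Context.exec (O : Oracle F n) (h : Context n d s σ) (P : Cmd)
    (hN : ∀ a ∈ constRegs, a ∉ P.nats) (hM : ∀ a ∈ [1, 2, 3], a ∉ P.flds) :
    Context n d s (P.exec O σ) :=
  h.of_frame (fun _ => P.exec_nat O σ) (fun _ => P.exec_fld O σ) hN hM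

variable (O : Oracle F n)

theorem exec_powerCmd (h : Context n d s σ) (hk : σ.nat 25 0 ≤ s)
    (hc : σ.nat 26 0 < d * (2 * n)) :
    (powerCmd.exec O σ).fld 11 0 = σ.fld 11 0 *
      (2 ^ (2 * n) ^ (σ.nat 26 0 / (2 * n))) ^ (σ.nat 26 0 % (2 * n) * σ.nat 25 0) := by
  have hn : 0 < 2 * n := Nat.pos_of_ne_zero fun h => by simp [h] at hc
  have ht : σ.nat 26 0 / (2 * n) < d := by rwa [Nat.div_lt_iff_lt_mul hn]
  have hl : σ.nat 26 0 % (2 * n) < 2 * n := Nat.mod_lt _ hn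
  set y : F := 2 ^ (2 * n) ^ (σ.nat 26 0 / (2 * n)) with hy
  -- The minimum in the invariant expresses that the rounds after the effective ones are idle; the
  -- same device serves for the other loops guarded by a test.
  have key := exec_loop O (v := 27) (r := 7) (σ := σ)
    (P := .ite (.natLt (.reg 27) (.mod (.reg 26) (.reg 7)))
      (.loop 28 5 (.ite (.natLt (.reg 28) (.reg 25))
        (.setFld 11 (.const 0) (.mul (.reg 11) (.get 3 (.div (.reg 26) (.reg 7))))) .skip)) .skip)
    (fun i τ => τ.fld 11 0 =
      σ.fld 11 0 * (y ^ σ.nat 25 0) ^ (min i (σ.nat 26 0 % (2 * n)))) (by simp) ?_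
  · rw [h.letters, min_eq_right hl.le, ← pow_mul, mul_comm (σ.nat 25 0)] at key
    exact key
  · intro i hi τ hv hN hM hI
    have h' : Context n d s τ := h.of_frame hN hM (by decide) (by decide)
    have e26 : τ.nat 26 = σ.nat 26 := hN 26 (by decide)
    have e25 : τ.nat 25 = σ.nat 25 := hN 25 (by decide)
    rw [State.setNat_fld, exec_ite]
    simp only [Test.holds, NExp.eval, hv, e26, h'.letters]
    split
    case isFalse hlt => rw [exec_skip, hI, min_eq_right (by omega), min_eq_right (by omega)]
    case isTrue hlt =>
      rw [min_eq_left (by omega : i ≤ _)] at hI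
      rw [min_eq_left (by omega : i + 1 ≤ _), pow_succ, ← mul_assoc, ← hI]
      have key := exec_loop O (v := 28) (r := 5) (σ := τ)
        (P := .ite (.natLt (.reg 28) (.reg 25))
          (.setFld 11 (.const 0) (.mul (.reg 11) (.get 3 (.div (.reg 26) (.reg 7))))) .skip)
        (fun i υ => υ.fld 11 0 = τ.fld 11 0 * y ^ (min i (σ.nat 25 0))) (by simp) ?_
      · rw [h'.sparsity, min_eq_right hk] at key
        exact key
      · intro j hj υ hv' hN' hM' hI'
        have h'' : Context n d s υ := h'.of_frame hN' hM' (by decide) (by decide)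
        have e26' : υ.nat 26 = σ.nat 26 := (hN' 26 (by decide)).trans e26
        have e25' : υ.nat 25 = σ.nat 25 := (hN' 25 (by decide)).trans e25
        rw [State.setNat_fld, exec_ite]
        simp only [Test.holds, NExp.eval, hv', e25']
        split
        case isFalse hlt => rw [exec_skip, hI', min_eq_right (by omega), min_eq_right (by omega)]
        case isTrue hlt =>
          rw [min_eq_left (by omega : j ≤ _)] at hI'
          rw [min_eq_left (by omega : j + 1 ≤ _), pow_succ, ← mul_assoc, ← hI', exec_setFld]
          simp [FExp.eval, NExp.eval, e26', h''.letters, h''.generic _ ht.le, hy]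

theorem exec_weightCmd (h : Context n d s σ) (hk : σ.nat 25 0 ≤ s) {t l : ℕ} (ht : t < d)
    (hl : l < 2 * n) :
    (weightCmd.exec O σ).fld 4 (t * (2 * n) + l) =
      testWeight (2 * n) (fun j => σ.nat 3 (σ.nat 36 0 + j)) (σ.nat 37 0) (σ.nat 25 0) t l := by
  have hn : 0 < 2 * n := by omega
  have key := exec_loop_fill O (v := 26) (r := 10) (b := 4) (σ := σ)
    (P := .seq
    (.seq (.setFld 11 (.const 0) .one)
      (.ite (.natLt (.div (.reg 26) (.reg 7)) (.reg 37))
        (.ite (.natEq (.mod (.reg 26) (.reg 7))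
            (.get 3 (.add (.reg 36) (.div (.reg 26) (.reg 7)))))
          .skip (.setFld 11 (.const 0) .zero))
        powerCmd))
    (.setFld 4 (.reg 26) (.reg 11)))
    (fun c => testWeight (2 * n) (fun j => σ.nat 3 (σ.nat 36 0 + j)) (σ.nat 37 0) (σ.nat 25 0)
      (c / (2 * n)) (c % (2 * n))) ?_ (t * (2 * n) + l) ?_
  · rwa [Nat.mul_comm t, Nat.mul_add_div hn, Nat.div_eq_of_lt hl, Nat.add_zero, Nat.mul_add_mod,
      Nat.mod_eq_of_lt hl, Nat.mul_comm _ t] at key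
  · intro i hi τ hv hN hM hI j hj
    have h' : Context n d s τ := h.of_frame hN hM (by decide) (by decide)
    have e25 : τ.nat 25 = σ.nat 25 := hN 25 (by decide)
    have e36 : τ.nat 36 = σ.nat 36 := hN 36 (by decide)
    have e37 : τ.nat 37 = σ.nat 37 := hN 37 (by decide)
    have e3 : τ.nat 3 = σ.nat 3 := hN 3 (by decide)
    rw [h.weights] at hi
    set A : Cmd := .seq (.setFld 11 (.const 0) .one)
      (.ite (.natLt (.div (.reg 26) (.reg 7)) (.reg 37))
        (.ite (.natEq (.mod (.reg 26) (.reg 7))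
            (.get 3 (.add (.reg 36) (.div (.reg 26) (.reg 7)))))
          .skip (.setFld 11 (.const 0) .zero))
        powerCmd) with hA
    have e26 : (A.exec O τ).nat 26 = τ.nat 26 := A.exec_nat O τ (by decide)
    have e4 : (A.exec O τ).fld 4 = τ.fld 4 := A.exec_fld O τ (by decide)
    rw [exec_seq, exec_setFld]
    simp only [State.setFld_fld, NExp.eval, FExp.eval, e26, hv, true_and]
    split
    case isFalse hne => rw [e4]; exact hI j (by omega)
    case isTrue heq =>
      subst heq
      rw [hA, exec_seq, exec_setFld, exec_ite, exec_ite]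
      simp only [Test.holds, NExp.eval, FExp.eval, State.setFld_nat, hv, h'.letters, e37, e36, e3]
      unfold testWeight
      split
      · split
        · simp [exec_skip]
        · simp [exec_setFld, NExp.eval, FExp.eval]
      · have h1 : Context n d s (τ.setFld 11 0 1) := h'.of_eq (fun _ _ => rfl)
          fun a ha => State.setFld_fld_of_ne _ (by rintro rfl; revert ha; decide)
        rw [exec_powerCmd O h1 (by simpa [e25] using hk) (by simpa [hv] using hi)]
        simp [hv, e25]
  · rw [h.weights]
    calc t * (2 * n) + l < t * (2 * n) + 2 * n := by omega
      _ = (t + 1) * (2 * n) := by ring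
      _ ≤ d * (2 * n) := Nat.mul_le_mul_right _ ht

/-- A weight matters only for a rise from the level of `p` to that of `q`. As the latter is at most
`d`, the former is below `d`, where the table is known to be correct. The numbers looked up are at
most `2 n`. -/
theorem eval_entry (h : Context n d s σ) {W : ℕ → ℕ → F}
    (hW : ∀ t < d, ∀ l < 2 * n, σ.fld 4 (t * (2 * n) + l) = W t l) {l p q : NExp}
    (hl : l.eval σ < 2 * n) (hq : q.eval σ < 4 * (d + 1)) :
    (FExp.entry l p q).eval σ = letterEntry W (l.eval σ) (p.eval σ) (q.eval σ) := by
  have hind (x y : ℕ) : (if x - y + (y - x) = 0 then (1 : F) else 0) = if x = y then 1 else 0 :=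
    if_congr (by omega) rfl rfl
  simp only [FExp.entry, FExp.ind, NExp.flip, NExp.level, NExp.side, NExp.bit, FExp.eval,
    NExp.eval, h.ind, h.letters, hind]
  generalize l.eval σ = x at *
  generalize p.eval σ = y at *
  generalize q.eval σ = z at *
  rw [letterEntry]
  congr 1
  · rcases Nat.mod_two_eq_zero_or_one (y / 2) with h1 | h1 <;>
      rcases Nat.mod_two_eq_zero_or_one (z / 2) with h2 | h2 <;>
      by_cases h3 : y / 4 = z / 4 <;> by_cases h4 : y % 2 = z % 2 <;> simp [h1, h2, h3, h4]
  · by_cases h1 : z / 4 = y / 4 + 1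
    swap
    · simp [h1]
    by_cases h2 : y / 2 % 2 = z / 2 % 2
    swap
    · simp [h2]
    have hf (u : ℕ) (hu : u < 2 * n) (s : ℕ) (hs : s < 2) : flipCode s u < 2 * n := by
      unfold flipCode; interval_cases s <;> omega
    have hy : y / 2 % 2 < 2 := by omega
    have hu := hf x hl _ hy
    have e (s u : ℕ) : u + s - 2 * (s * (u % 2)) = flipCode s u := rfl
    simp only [h1, h2, if_true, and_self, one_mul, e]
    rw [h2] at hu hy
    set u := flipCode (z / 2 % 2) x with hu'
    have hr : y % 2 = 0 ∨ y % 2 = 1 := by omega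
    have hr' : z % 2 = 0 ∨ z % 2 = 1 := by omega
    have hx : x % 2 = 0 ∨ x % 2 = 1 := by omega
    have hb := hf u hu 1 (by omega)
    rw [hW _ (by omega) _ hu, h.cast (1 + y % 2 * u) (by rcases hr with h | h <;> rw [h] <;> omega),
      h.cast _ (by omega), h.cast (z % 2) (by omega)]
    congr 1
    · congr 2
      unfold letterSign
      rcases hx with h | h <;> simp [h]
    · unfold rowVec
      rcases hr' with h | h <;> simp [h, flipCode]

theorem exec_matrixCmd (h : Context n d s σ) {W : ℕ → ℕ → F}
    (hW : ∀ t < d, ∀ l < 2 * n, σ.fld 4 (t * (2 * n) + l) = W t l) {i p q : ℕ} (hi : i < n)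
    (hp : p < 4 * (d + 1)) (hq : q < 4 * (d + 1)) :
    (matrixCmd.exec O σ).fld 5 ((i * (4 * (d + 1)) + p) * (4 * (d + 1)) + q) =
      letterEntry W (2 * i) p q := by
  set D := 4 * (d + 1) with hD
  have hD0 : 0 < D := by omega
  have key := exec_loop_fill O (v := 29) (r := 9) (b := 5) (σ := σ)
    (P := .setFld 5 (.reg 29)
      (.entry (.mul (.const 2) (.div (.div (.reg 29) (.reg 8)) (.reg 8)))
        (.mod (.div (.reg 29) (.reg 8)) (.reg 8)) (.mod (.reg 29) (.reg 8))))
    (fun c => letterEntry W (2 * (c / D / D)) (c / D % D) (c % D)) ?_ ((i * D + p) * D + q) ?_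
  · have h1 : ((i * D + p) * D + q) / D = i * D + p := by
      rw [Nat.mul_comm _ D, Nat.mul_add_div hD0, Nat.div_eq_of_lt hq, Nat.add_zero]
    have h2 : ((i * D + p) * D + q) % D = q := by
      rw [Nat.mul_comm _ D, Nat.mul_add_mod, Nat.mod_eq_of_lt hq]
    have h3 : (i * D + p) / D = i := by
      rw [Nat.mul_comm _ D, Nat.mul_add_div hD0, Nat.div_eq_of_lt hp, Nat.add_zero]
    have h4 : (i * D + p) % D = p := by
      rw [Nat.mul_comm _ D, Nat.mul_add_mod, Nat.mod_eq_of_lt hp]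
    rw [h1, h2, h3, h4] at key
    exact key
  · intro c hc τ hv hN hM hI j hj
    have h' : Context n d s τ := h.of_frame hN hM (by decide) (by decide)
    have e4 : τ.fld 4 = σ.fld 4 := hM 4 (by decide)
    rw [h.entries] at hc
    have hcn : c / D / D < n := by
      rw [Nat.div_lt_iff_lt_mul hD0, Nat.div_lt_iff_lt_mul hD0]
      exact hc
    rw [exec_setFld, eval_entry h' (by rw [e4]; exact hW)]
    · simp only [State.setFld_fld, NExp.eval, hv, h'.dim, true_and]
      split
      case isTrue heq => rw [heq]
      case isFalse hne => exact hI j (by omega)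
    · simp only [NExp.eval, hv, h'.dim, ← hD]; omega
    · simp only [NExp.eval, hv, h'.dim]; exact Nat.mod_lt _ hD0
  · rw [h.entries]
    calc (i * D + p) * D + q < (i * D + p) * D + D := by omega
      _ = (i * D + p + 1) * D := by ring
      _ ≤ ((i + 1) * D) * D := by gcongr; rw [add_mul]; omega
      _ ≤ n * D * D := by gcongr; exact hi

/-- The query is admissible because the matrices written are those of `letterUnit`, invertible
whatever the weights are. -/
theorem exec_queryCmd (h : Context n d s σ) (hk : σ.nat 25 0 ≤ s) {W : ℕ → ℕ → F}
    (hW : W = testWeight (2 * n) (fun j => σ.nat 3 (σ.nat 36 0 + j)) (σ.nat 37 0) (σ.nat 25 0)) :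
    queryCmd.Safe O σ ∧
      (∀ t < d, ∀ l < 2 * n, (queryCmd.exec O σ).fld 4 (t * (2 * n) + l) = W t l) ∧
      ∀ j (hj : j < 4 * (d + 1)), (queryCmd.exec O σ).fld 6 j =
        O (4 * (d + 1)) (fun i => letterUnit W d i) ⟨0, by omega⟩ ⟨j, hj⟩ := by
  set τ := weightCmd.exec O σ with hτ
  set υ := matrixCmd.exec O τ with hυ
  have hτc : Context n d s τ := h.exec O weightCmd (by decide) (by decide)
  have hυc : Context n d s υ := hτc.exec O matrixCmd (by decide) (by decide)
  have h4 : ∀ t < d, ∀ l < 2 * n, τ.fld 4 (t * (2 * n) + l) = W t l := fun t ht l hl => by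
    rw [hW]; exact exec_weightCmd O h hk ht hl
  obtain ⟨hs, he⟩ := exec_query O (k := 8) (a := 5) (b := 6) hυc.dim (fun i => letterUnit W d i) (by
    intro i
    ext p q
    exact (exec_matrixCmd O hτc h4 i.2 p.2 q.2).symm)
  have hexec : queryCmd.exec O σ = υ.writeMatrix 6 (4 * (d + 1))
    (O (4 * (d + 1)) (fun i => letterUnit W d i)) := he
  refine ⟨⟨Cmd.safe_of_queryFree O _ _ (by decide), Cmd.safe_of_queryFree O _ _ (by decide), hs⟩,
    fun t ht l hl => ?_, fun j hj => ?_⟩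
  · rw [← h4 t ht l hl]
    exact congrFun (Cmd.exec_fld O (.seq matrixCmd (.query 8 5 6)) τ (by decide)) _
  · rw [hexec, writeMatrix_fld_zero]

theorem letterStep_congr (W : ℕ → ℕ → F) {l : ℕ} {v v' : ℕ → F}
    (hv : ∀ p < 4 * (d + 1), v p = v' p) (q : ℕ) :
    letterStep W d l v q = letterStep W d l v' q :=
  Finset.sum_congr rfl fun p hp => by rw [hv p (Finset.mem_range.1 hp)]

/-- The product is accumulated in the array 8 and copied afterwards, since the old vector in the
array 7 is read until the last entry is finished. -/
theorem exec_stepCmd (h : Context n d s σ) {W : ℕ → ℕ → F}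
    (hW : ∀ t < d, ∀ l < 2 * n, σ.fld 4 (t * (2 * n) + l) = W t l) (hl : σ.nat 32 0 < 2 * n)
    {q : ℕ} (hq : q < 4 * (d + 1)) :
    (stepCmd.exec O σ).fld 7 q = letterStep W d (σ.nat 32 0) (σ.fld 7) q := by
  set A : Cmd := .loop 33 8 (.seq (.setFld 8 (.reg 33) .zero)
      (.loop 34 8 (.setFld 8 (.reg 33) (.add (.get 8 (.reg 33))
        (.mul (.get 7 (.reg 34)) (.entry (.reg 32) (.reg 34) (.reg 33))))))) with hA
  have h1 : ∀ q < 4 * (d + 1),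
      (A.exec O σ).fld 8 q = letterStep W d (σ.nat 32 0) (σ.fld 7) q := by
    rw [← h.dim]
    refine exec_loop_fill O _ ?_
    intro i hi τ hv hN hM hI j hj
    have h' : Context n d s τ := h.of_frame hN hM (by decide) (by decide)
    have e4 : τ.fld 4 = σ.fld 4 := hM 4 (by decide)
    have e7 : τ.fld 7 = σ.fld 7 := hM 7 (by decide)
    have e32 : τ.nat 32 = σ.nat 32 := hN 32 (by decide)
    rw [exec_seq, exec_setFld]
    set υ := τ.setFld 8 ((NExp.reg 33).eval τ) (FExp.zero.eval τ) with hυ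
    have hυn : υ.nat = τ.nat := rfl
    have hυ8 (j : ℕ) : υ.fld 8 j = if j = i then 0 else τ.fld 8 j := by
      simp [hυ, NExp.eval, FExp.eval, hv]
    have hυf (a : ℕ) (ha : a ≠ 8) : υ.fld a = τ.fld a := State.setFld_fld_of_ne _ ha
    have hυc : Context n d s υ := h'.of_eq (fun _ _ => rfl)
      fun a ha => hυf a (by rintro rfl; revert ha; decide)
    have key := exec_loop O (v := 34) (r := 8) (σ := υ)
      (P := .setFld 8 (.reg 33) (.add (.get 8 (.reg 33))
        (.mul (.get 7 (.reg 34)) (.entry (.reg 32) (.reg 34) (.reg 33)))))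
      (fun k ρ => (∀ j < i, ρ.fld 8 j = letterStep W d (σ.nat 32 0) (σ.fld 7) j) ∧
        ρ.fld 8 i = ∑ p ∈ Finset.range k, σ.fld 7 p * letterEntry W (σ.nat 32 0) p i) ?_ ?_
    · rw [hυc.dim] at key
      rcases hj.lt_or_eq with hlt | rfl
      · exact key.1 j hlt
      · exact key.2
    · refine ⟨fun j hj => ?_, ?_⟩
      · rw [State.setNat_fld, hυ8, if_neg (by omega), hI j hj]
      · rw [State.setNat_fld, hυ8]; simp
    · intro k hk ρ hv' hN' hM' hI'
      have h'' : Context n d s ρ := hυc.of_frame hN' hM' (by decide) (by decide)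
      have f4 : ρ.fld 4 = σ.fld 4 := (hM' 4 (by decide)).trans ((hυf 4 (by decide)).trans e4)
      have f7 : ρ.fld 7 = σ.fld 7 := (hM' 7 (by decide)).trans ((hυf 7 (by decide)).trans e7)
      have f32 : ρ.nat 32 = σ.nat 32 := (hN' 32 (by decide)).trans e32
      have f33 : ρ.nat 33 0 = i := by rw [hN' 33 (by decide), hυn, hv]
      rw [State.setNat_fld, exec_setFld]
      simp only [FExp.eval, State.setFld_fld, true_and]
      rw [eval_entry h'' (by rw [f4]; exact hW)]
      · simp only [NExp.eval, f33, f7, f32, hv']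
        refine ⟨fun j hj => ?_, ?_⟩
        · rw [if_neg (by omega), hI'.1 j hj]
        · rw [if_pos trivial, hI'.2, Finset.sum_range_succ]
      · simpa [NExp.eval, f32] using hl
      · simp only [NExp.eval, f33]; rw [h.dim] at hi; exact hi
  have hAc : Context n d s (A.exec O σ) := h.exec O A (by decide) (by decide)
  have h2 := exec_loop_fill O (v := 33) (r := 8) (b := 7) (σ := A.exec O σ)
    (P := .setFld 7 (.reg 33) (.get 8 (.reg 33))) ((A.exec O σ).fld 8) (by
      intro i hi τ hv hN hM hI j hj
      have e8 : τ.fld 8 = (A.exec O σ).fld 8 := hM 8 (by decide)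
      rw [exec_setFld]
      simp only [State.setFld_fld, NExp.eval, FExp.eval, hv, true_and, e8]
      split
      case isTrue heq => rw [heq]
      case isFalse hne => exact hI j (by omega)) q (by rwa [hAc.dim])
  exact h2.trans (h1 q hq)

/-- The word with the number `τ` in the memory. -/
def State.word (σ : State F) (d τ : ℕ) : List ℕ :=
  (List.range (σ.nat 2 τ)).map fun j => σ.nat 3 (τ * d + j)

theorem exec_wordCmd (h : Context n d s σ) {W : ℕ → ℕ → F}
    (hW : ∀ t < d, ∀ l < 2 * n, σ.fld 4 (t * (2 * n) + l) = W t l)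
    (hlen : σ.nat 2 (σ.nat 30 0) ≤ d) (hl : ∀ l ∈ σ.word d (σ.nat 30 0), l < 2 * n)
    {q : ℕ} (hq : q < 4 * (d + 1)) :
    (wordCmd.exec O σ).fld 7 q = wordVec W d (σ.word d (σ.nat 30 0)) q := by
  set x := σ.nat 30 0 with hx
  set A : Cmd := .loop 33 8 (.setFld 7 (.reg 33) (.get 1 (.reg 33))) with hA
  have hAc : Context n d s (A.exec O σ) := h.exec O A (by decide) (by decide)
  have h1 : ∀ q < 4 * (d + 1), (A.exec O σ).fld 7 q = wordVec W d [] q := by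
    rw [← h.dim]
    refine exec_loop_fill O _ ?_
    intro i hi τ hv hN hM hI j hj
    have e1 : τ.fld 1 = σ.fld 1 := hM 1 (by decide)
    rw [exec_setFld]
    simp only [State.setFld_fld, NExp.eval, FExp.eval, hv, true_and, e1]
    split
    case isTrue heq => rw [heq, h.ind]; rfl
    case isFalse hne => exact hI j (by omega)
  have key := exec_loop O (v := 31) (r := 4) (σ := A.exec O σ)
    (P := .ite (.natLt (.reg 31) (.get 2 (.reg 30)))
      (.loop 32 7 (.ite
        (.natEq (.reg 32) (.get 3 (.add (.mul (.reg 30) (.reg 4)) (.reg 31)))) stepCmd .skip))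
      .skip)
    (fun i τ => ∀ q < 4 * (d + 1), τ.fld 7 q = wordVec W d
      ((List.range (min i (σ.nat 2 x))).map fun j => σ.nat 3 (x * d + j)) q) (by simpa using h1) ?_
  · rw [hAc.degree, min_eq_right hlen] at key
    exact key q hq
  · intro i hi τ hv hN hM hI
    have h' : Context n d s τ := hAc.of_frame hN hM (by decide) (by decide)
    have e2 : τ.nat 2 = σ.nat 2 := (hN 2 (by decide)).trans (A.exec_nat O σ (by decide))
    have e3 : τ.nat 3 = σ.nat 3 := (hN 3 (by decide)).trans (A.exec_nat O σ (by decide))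
    have e30 : τ.nat 30 = σ.nat 30 := (hN 30 (by decide)).trans (A.exec_nat O σ (by decide))
    have e4 : τ.fld 4 = σ.fld 4 := (hM 4 (by decide)).trans (A.exec_fld O σ (by decide))
    rw [State.setNat_fld, exec_ite]
    simp only [Test.holds, NExp.eval, hv, e2, e30, ← hx]
    split
    case isFalse hlt =>
      intro q hq
      rw [exec_skip, hI q hq, min_eq_right (by omega), min_eq_right (by omega)]
    case isTrue hlt =>
      set y := σ.nat 3 (x * d + i) with hy
      have hyn : y < 2 * n := hl _ (List.mem_map.2 ⟨i, List.mem_range.2 hlt, rfl⟩)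
      -- The letter is found by running through all codes, because the entries involve remainders
      -- and products of it: these are allowed for a loop variable, which is bounded, but not for
      -- the content of a memory cell.
      have key := exec_loop O (v := 32) (r := 7) (σ := τ)
        (P := .ite (.natEq (.reg 32)
          (.get 3 (.add (.mul (.reg 30) (.reg 4)) (.reg 31)))) stepCmd .skip)
        (fun k υ => ∀ q < 4 * (d + 1), υ.fld 7 q =
          if y < k then letterStep W d y (τ.fld 7) q else τ.fld 7 q) (by simp) ?_
      · intro q hq
        rw [key q hq, h'.letters, if_pos hyn, min_eq_left (by omega), List.range_succ,
          List.map_append, List.map_singleton, wordVec_concat]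
        refine letterStep_congr W (fun p hp => ?_) q
        rw [hI p hp, min_eq_left (by omega)]
      · intro k hk υ hv' hN' hM' hI' q hq
        have h'' : Context n d s υ := h'.of_frame hN' hM' (by decide) (by decide)
        have f3 : υ.nat 3 = σ.nat 3 := (hN' 3 (by decide)).trans e3
        have f30 : υ.nat 30 0 = x := by rw [hN' 30 (by decide), e30]
        have f31 : υ.nat 31 0 = i := by rw [hN' 31 (by decide), hv]
        have f4 : υ.fld 4 = σ.fld 4 := (hM' 4 (by decide)).trans e4
        rw [State.setNat_fld, exec_ite]
        simp only [Test.holds, NExp.eval, hv', f3, f30, f31, h''.degree, ← hy]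
        split
        case isFalse hne =>
          rw [exec_skip, hI' q hq]
          exact if_congr (by omega) rfl rfl
        case isTrue heq =>
          rw [exec_stepCmd O h'' (by rw [f4]; exact hW) (by rw [hv', heq]; exact hyn) hq,
            if_pos (by omega), hv', heq]
          refine letterStep_congr W (fun p hp => ?_) q
          rw [hI' p hp, if_neg (by omega)]

/-- The value of the candidate word has its own hypotheses, so that the subtraction can be used even
if the cells behind the known terms contain no word. -/
theorem exec_subtractCmd (h : Context n d s σ) {W : ℕ → ℕ → F}
    (hW : ∀ t < d, ∀ l < 2 * n, σ.fld 4 (t * (2 * n) + l) = W t l) (hcnt : σ.nat 1 0 ≤ s)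
    (hK : σ.nat 21 0 ≤ d) (hlen : ∀ x < σ.nat 1 0, σ.nat 2 x ≤ d)
    (hl : ∀ x < σ.nat 1 0, ∀ l ∈ σ.word d x, l < 2 * n) :
    (subtractCmd.exec O σ).fld 9 0 = σ.fld 9 0 - ∑ x ∈ Finset.range (σ.nat 1 0),
        σ.fld 0 x * wordVec W d (σ.word d x) (4 * σ.nat 21 0) ∧
      (σ.nat 2 (σ.nat 1 0) ≤ d → (∀ l ∈ σ.word d (σ.nat 1 0), l < 2 * n) →
        (subtractCmd.exec O σ).fld 10 0 =
          wordVec W d (σ.word d (σ.nat 1 0)) (4 * σ.nat 21 0)) := by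
  have key := exec_loop O (v := 30) (r := 6) (σ := σ)
    (P := .ite (.natLt (.reg 1) (.reg 30)) .skip
    (.seq wordCmd (.ite (.natLt (.reg 30) (.reg 1))
      (.setFld 9 (.const 0) (.sub (.reg 9) (.mul (.get 0 (.reg 30)) (.get 7 .target))))
      (.setFld 10 (.const 0) (.get 7 .target)))))
    (fun i τ => τ.fld 9 0 = σ.fld 9 0 - ∑ x ∈ Finset.range (min i (σ.nat 1 0)),
        σ.fld 0 x * wordVec W d (σ.word d x) (4 * σ.nat 21 0) ∧
      (σ.nat 1 0 < i → σ.nat 2 (σ.nat 1 0) ≤ d → (∀ l ∈ σ.word d (σ.nat 1 0), l < 2 * n) →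
        τ.fld 10 0 = wordVec W d (σ.word d (σ.nat 1 0)) (4 * σ.nat 21 0))) (by simp) ?_
  · rw [h.terms, min_eq_right (by omega)] at key
    exact ⟨key.1, key.2 (by omega)⟩
  · intro i hi τ hv hN hM hI
    have h' : Context n d s τ := h.of_frame hN hM (by decide) (by decide)
    have e1 : τ.nat 1 = σ.nat 1 := hN 1 (by decide)
    have e2 : τ.nat 2 = σ.nat 2 := hN 2 (by decide)
    have e3 : τ.nat 3 = σ.nat 3 := hN 3 (by decide)
    have e21 : τ.nat 21 = σ.nat 21 := hN 21 (by decide)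
    have e4 : τ.fld 4 = σ.fld 4 := hM 4 (by decide)
    have e0 : τ.fld 0 = σ.fld 0 := hM 0 (by decide)
    have eword : τ.word d i = σ.word d i := by simp only [State.word, e2, e3]
    simp only [State.setNat_fld]
    rw [exec_ite]
    simp only [Test.holds, NExp.eval, hv, e1]
    split
    case isTrue hlt =>
      rw [exec_skip, min_eq_right (by omega)]
      rw [min_eq_right (by omega)] at hI
      exact ⟨hI.1, fun _ => hI.2 hlt⟩
    case isFalse hle =>
      rw [min_eq_left (by omega)] at hI
      set υ := wordCmd.exec O τ with hυ
      have f1 : υ.nat 1 0 = σ.nat 1 0 := by rw [wordCmd.exec_nat O τ (by decide), e1]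
      have f30 : υ.nat 30 0 = i := by rw [wordCmd.exec_nat O τ (by decide), hv]
      have f21 : υ.nat 21 0 = σ.nat 21 0 := by rw [wordCmd.exec_nat O τ (by decide), e21]
      have f9 : υ.fld 9 0 = τ.fld 9 0 := by rw [wordCmd.exec_fld O τ (by decide)]
      have f0 : υ.fld 0 i = σ.fld 0 i := by rw [wordCmd.exec_fld O τ (by decide), e0]
      have f7 (hlen : σ.nat 2 i ≤ d) (hl : ∀ l ∈ σ.word d i, l < 2 * n) :
          υ.fld 7 (4 * σ.nat 21 0) = wordVec W d (σ.word d i) (4 * σ.nat 21 0) := by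
        have := exec_wordCmd O h' (by rw [e4]; exact hW) (by rw [hv, e2]; exact hlen)
          (by rw [hv, eword]; exact hl) (q := 4 * σ.nat 21 0) (by omega)
        rwa [hv, eword] at this
      have ht : NExp.target.eval υ = 4 * σ.nat 21 0 := by
        simp only [NExp.target, NExp.eval, f21]; omega
      rw [exec_seq, ← hυ, exec_ite]
      simp only [Test.holds, NExp.eval, f30, f1]
      split
      case isTrue hlt =>
        rw [exec_setFld, min_eq_left (by omega), Finset.sum_range_succ]
        refine ⟨?_, fun hlt' => by omega⟩
        simp only [FExp.eval, NExp.eval, State.setFld_fld, and_self, if_true, ht, f30, f9, f0,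
          f7 (hlen i hlt) (hl i hlt), hI.1]
        ring
      case isFalse hge =>
        have heq : i = σ.nat 1 0 := by omega
        rw [exec_setFld, min_eq_right (by omega)]
        refine ⟨?_, fun _ h1 h2 => ?_⟩
        · simp [FExp.eval, NExp.eval, f9, hI.1, heq]
        · rw [← heq] at h1 h2
          simp [FExp.eval, NExp.eval, ht, f7 h1 h2, heq]

theorem exec_valueCmd (h : Context n d s σ) (hk : σ.nat 25 0 ≤ s) (hcnt : σ.nat 1 0 ≤ s)
    (hK : σ.nat 21 0 ≤ d) (hlen : ∀ x < σ.nat 1 0, σ.nat 2 x ≤ d)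
    (hl : ∀ x < σ.nat 1 0, ∀ l ∈ σ.word d x, l < 2 * n) {W : ℕ → ℕ → F}
    (hW : W = testWeight (2 * n) (fun j => σ.nat 3 (σ.nat 36 0 + j)) (σ.nat 37 0) (σ.nat 25 0)) :
    valueCmd.Safe O σ ∧
      (valueCmd.exec O σ).fld 9 0 = O (4 * (d + 1)) (fun i => letterUnit W d i) ⟨0, by omega⟩
          ⟨4 * σ.nat 21 0, by omega⟩ - ∑ x ∈ Finset.range (σ.nat 1 0),
            σ.fld 0 x * wordVec W d (σ.word d x) (4 * σ.nat 21 0) ∧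
      (σ.nat 2 (σ.nat 1 0) ≤ d → (∀ l ∈ σ.word d (σ.nat 1 0), l < 2 * n) →
        (valueCmd.exec O σ).fld 10 0 =
          wordVec W d (σ.word d (σ.nat 1 0)) (4 * σ.nat 21 0)) := by
  obtain ⟨hs, h4, h6⟩ := exec_queryCmd O h hk hW
  set τ := queryCmd.exec O σ with hτ
  set υ := τ.setFld 9 0 (τ.fld 6 (NExp.target.eval τ)) with hυ
  have hτc : Context n d s τ := h.exec O queryCmd (by decide) (by decide)
  have hυc : Context n d s υ := hτc.of_eq (fun _ _ => rfl)
    fun a ha => State.setFld_fld_of_ne _ (by rintro rfl; revert ha; decide)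
  have hnat (a : ℕ) (ha : a ∉ queryCmd.nats) : υ.nat a = σ.nat a := queryCmd.exec_nat O σ ha
  have e1 : υ.nat 1 = σ.nat 1 := hnat 1 (by decide)
  have e2 : υ.nat 2 = σ.nat 2 := hnat 2 (by decide)
  have e3 : υ.nat 3 = σ.nat 3 := hnat 3 (by decide)
  have e21 : υ.nat 21 = σ.nat 21 := hnat 21 (by decide)
  have e0 : υ.fld 0 = σ.fld 0 :=
    (State.setFld_fld_of_ne _ (by decide)).trans (queryCmd.exec_fld O σ (by decide))
  have e4 : υ.fld 4 = τ.fld 4 := State.setFld_fld_of_ne _ (by decide)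
  have e9 : υ.fld 9 0 = O (4 * (d + 1)) (fun i => letterUnit W d i) ⟨0, by omega⟩
      ⟨4 * σ.nat 21 0, by omega⟩ := by
    have ht : NExp.target.eval τ = 4 * σ.nat 21 0 := by
      have : τ.nat 21 = σ.nat 21 := e21
      simp only [NExp.target, NExp.eval, this]; omega
    rw [hυ, State.setFld_fld, if_pos ⟨rfl, rfl⟩, ht]
    exact h6 _ _
  have eword (x : ℕ) : υ.word d x = σ.word d x := by simp only [State.word, e2, e3]
  have key := exec_subtractCmd O hυc (W := W) (by rw [e4]; exact h4) (by rwa [e1]) (by rwa [e21])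
    (by rw [e1, e2]; exact hlen) (by simp only [e1, eword]; exact hl)
  simp only [e1, e2, e21, e0, e9, eword] at key
  exact ⟨⟨hs, trivial, Cmd.safe_of_queryFree O _ _ (by decide)⟩, key⟩

end Specification

end AlgRAM

namespace AlgRAM

/-! ### The search for the terms -/

section MainProgram

/-- Test whether a remaining word of length `K` has the current prefix. -/
def testCmd : Cmd :=
  .loop 25 5 (.seq valueCmd
    (.ite (.fldEq (.reg 9) .zero) .skip (.setNat 35 (.const 0) (.const 1))))

/-- Search for the next letter of the current word. -/
def letterCmd : Cmd :=
  .loop 24 7 (.ite (.natEq (.reg 35) (.const 0))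
    (.seq (.setNat 3 (.add (.reg 36) (.reg 23)) (.reg 24)) testCmd) .skip)

/-- Search for a remaining word of length `K`. -/
def searchCmd : Cmd :=
  .loop 23 4 (.ite (.natLt (.reg 23) (.reg 21))
    (.seq (.setNat 35 (.const 0) (.const 0))
      (.seq (.setNat 37 (.const 0) (.add (.reg 23) (.const 1))) letterCmd)) .skip)

/-- Append the current word with its coefficient to the output. -/
def appendCmd : Cmd :=
  .seq (.setFld 0 (.reg 1) (.mul (.reg 9) (.inv (.reg 10))))
    (.seq (.setNat 1 (.const 0) (.add (.reg 1) (.const 1)))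
      (.setNat 36 (.const 0) (.add (.reg 36) (.reg 4))))

/-- Append the current word to the output if it has a nonzero coefficient. -/
def finishCmd : Cmd :=
  -- The prefix is now the whole word, so no generic weight enters on the levels below `K` and the
  -- exponent 0 suffices.
  .seq (.setNat 37 (.const 0) (.reg 21)) (.seq (.setNat 25 (.const 0) (.const 0))
    (.seq valueCmd (.ite (.fldEq (.reg 9) .zero) .skip appendCmd)))

/-- Search for one more term with a word of length `K`. -/
def roundCmd : Cmd :=
  .seq (.setNat 2 (.reg 1) (.reg 21)) (.seq searchCmd finishCmd)

/-- Search for all terms, by decreasing length. -/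
def mainCmd : Cmd :=
  .loop 20 11 (.seq (.setNat 21 (.const 0) (.sub (.reg 4) (.reg 20))) (.loop 22 5 roundCmd))

/-- The tables of indicators, numbers and generic weights. -/
def tableCmd : Cmd :=
  .seq (.setFld 1 (.const 0) .one)
    (.seq (.loop 24 7 (.setFld 2 (.add (.reg 24) (.const 1)) (.add (.get 2 (.reg 24)) .one)))
      (.seq (.setFld 3 (.const 0) (.add .one .one))
        (.loop 23 4 (.seq (.setFld 11 (.const 0) .one)
          (.seq (.loop 24 7 (.setFld 11 (.const 0) (.mul (.reg 11) (.get 3 (.reg 23)))))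
            (.setFld 3 (.add (.reg 23) (.const 1)) (.reg 11)))))))

/-- The constants computed by additions. -/
def sumCmd : Cmd :=
  .seq (.setNat 4 (.const 0) (.get 0 (.const 1))) (.seq (.setNat 5 (.const 0) (.get 0 (.const 2)))
    (.seq (.setNat 6 (.const 0) (.add (.reg 5) (.const 1)))
      (.seq (.setNat 7 (.const 0) (.add (.reg 0) (.reg 0)))
        (.seq (.setNat 11 (.const 0) (.add (.reg 4) (.const 1)))
          (.setNat 8 (.const 0) (.add (.add (.reg 11) (.reg 11)) (.add (.reg 11) (.reg 11))))))))

/-- The constants computed by multiplications. -/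
def productCmd : Cmd :=
  .seq (.setNat 9 (.const 0) (.mul (.mul (.reg 0) (.reg 8)) (.reg 8)))
    (.setNat 10 (.const 0) (.mul (.reg 4) (.reg 7)))

end MainProgram

/-! ### Constants and tables -/

section Setup

variable {F : Type*} [Field F] {n : ℕ} (O : Oracle F n)

/-- The memory after the computation of the constants. -/
noncomputable def start (O : Oracle F n) (d s : ℕ) : State F :=
  productCmd.exec O (sumCmd.exec O (init F n d s))

theorem start_fld (d s : ℕ) (a i : ℕ) : (start O d s).fld a i = 0 := by
  rw [start, productCmd.exec_fld O _ (by simp [productCmd, Cmd.flds]),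
    sumCmd.exec_fld O _ (by simp [sumCmd, Cmd.flds])]
  rfl

theorem context_tableCmd (d s : ℕ) : Context n d s (tableCmd.exec O (start O d s)) := by
  set σ := start O d s with hσ
  have hn (a : ℕ) (ha : a ∈ constRegs) : (tableCmd.exec O σ).nat a = σ.nat a :=
    tableCmd.exec_nat O σ (by revert a; decide)
  have e7 : σ.nat 7 0 = 2 * n := by
    simp [hσ, start, productCmd, sumCmd, Cmd.exec, NExp.eval, init]; omega
  have e4 : σ.nat 4 0 = d := by
    simp [hσ, start, productCmd, sumCmd, Cmd.exec, NExp.eval, init]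
  set A : Cmd := .setFld 1 (.const 0) .one with hA
  set B : Cmd := .loop 24 7 (.setFld 2 (.add (.reg 24) (.const 1)) (.add (.get 2 (.reg 24)) .one))
    with hB
  set C : Cmd := .setFld 3 (.const 0) (.add .one .one) with hC
  set D : Cmd := .loop 23 4 (.seq (.setFld 11 (.const 0) .one)
          (.seq (.loop 24 7 (.setFld 11 (.const 0) (.mul (.reg 11) (.get 3 (.reg 23)))))
            (.setFld 3 (.add (.reg 23) (.const 1)) (.reg 11)))) with hD
  have hexec : tableCmd.exec O σ = D.exec O (C.exec O (B.exec O (A.exec O σ))) := rfl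
  refine ⟨?_, ?_, ?_, ?_, ?_, ?_, ?_, ?_, ?_, ?_, ?_, ?_⟩
  · rw [hn 0 (by decide)]
    simp [hσ, start, productCmd, sumCmd, Cmd.exec, NExp.eval, init]
  · rw [hn 4 (by decide), e4]
  · rw [hn 5 (by decide)]
    simp [hσ, start, productCmd, sumCmd, Cmd.exec, NExp.eval, init]
  · rw [hn 6 (by decide)]
    simp [hσ, start, productCmd, sumCmd, Cmd.exec, NExp.eval, init]
  · rw [hn 7 (by decide), e7]
  · rw [hn 8 (by decide)]
    simp [hσ, start, productCmd, sumCmd, Cmd.exec, NExp.eval, init]; omega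
  · rw [hn 9 (by decide)]
    simp [hσ, start, productCmd, sumCmd, Cmd.exec, NExp.eval, init]
    rw [show d + 1 + (d + 1) + (d + 1 + (d + 1)) = 4 * (d + 1) by ring]
  · rw [hn 10 (by decide)]
    simp [hσ, start, productCmd, sumCmd, Cmd.exec, NExp.eval, init, two_mul]
  · rw [hn 11 (by decide)]
    simp [hσ, start, productCmd, sumCmd, Cmd.exec, NExp.eval, init]
  · intro i
    rw [hexec, D.exec_fld O _ (by decide), C.exec_fld O _ (by decide), B.exec_fld O _ (by decide),
      hA, exec_setFld, State.setFld_fld]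
    simp only [NExp.eval, FExp.eval, true_and]
    rw [start_fld]
  · rw [hexec, D.exec_fld O _ (by decide), C.exec_fld O _ (by decide)]
    have key := exec_loop O (v := 24) (r := 7) (σ := A.exec O σ)
      (P := .setFld 2 (.add (.reg 24) (.const 1)) (.add (.get 2 (.reg 24)) .one))
      (fun i τ => ∀ j ≤ i, τ.fld 2 j = (j : F)) ?_ ?_
    · rwa [A.exec_nat O σ (by decide), e7] at key
    · intro j hj
      obtain rfl : j = 0 := by omega
      rw [State.setNat_fld, A.exec_fld O σ (by decide), start_fld, Nat.cast_zero]
    · intro i hi τ hv hN hM hI j hj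
      rw [State.setNat_fld, exec_setFld]
      simp only [NExp.eval, FExp.eval, State.setFld_fld, hv, true_and]
      split
      case isTrue heq => rw [heq, hI i le_rfl]; push_cast; rfl
      case isFalse hne => exact hI j (by omega)
  · rw [hexec]
    set τ := C.exec O (B.exec O (A.exec O σ)) with hτ
    have hτn (a : ℕ) (ha : a ≠ 24) : τ.nat a = σ.nat a := by
      rw [hτ, C.exec_nat O _ (by simp [hC, Cmd.nats]), B.exec_nat O _ (by simp [hB, Cmd.nats, ha]),
        A.exec_nat O _ (by simp [hA, Cmd.nats])]
    have key := exec_loop O (v := 23) (r := 4) (σ := τ)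
      (P := .seq (.setFld 11 (.const 0) .one)
          (.seq (.loop 24 7 (.setFld 11 (.const 0) (.mul (.reg 11) (.get 3 (.reg 23)))))
            (.setFld 3 (.add (.reg 23) (.const 1)) (.reg 11))))
      (fun i τ => ∀ t ≤ i, τ.fld 3 t = (2 : F) ^ (2 * n) ^ t) ?_ ?_
    · rwa [hτn 4 (by decide), e4] at key
    · intro j hj
      obtain rfl : j = 0 := by omega
      rw [State.setNat_fld, hτ, hC, exec_setFld, State.setFld_fld, if_pos ⟨rfl, rfl⟩]
      simp [FExp.eval, one_add_one_eq_two]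
    · intro i hi υ hv hN hM hI j hj
      have f7 : υ.nat 7 0 = 2 * n := by rw [hN 7 (by decide), hτn 7 (by decide), e7]
      rw [State.setNat_fld, exec_seq, exec_seq, exec_setFld, exec_setFld]
      set υ' := υ.setFld 11 ((NExp.const 0).eval υ) (FExp.one.eval υ) with hυ'
      -- The next generic weight is the `2 n`-th power of the previous one, so `2 n` multiplications
      -- per level produce doubly exponential numbers.
      have key := exec_loop O (v := 24) (r := 7) (σ := υ')
        (P := .setFld 11 (.const 0) (.mul (.reg 11) (.get 3 (.reg 23))))
        (fun k ρ => ρ.fld 11 0 = ((2 : F) ^ (2 * n) ^ i) ^ k ∧ ρ.fld 3 = υ.fld 3 ∧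
          ρ.nat 23 = υ.nat 23) ?_ ?_
      · rw [show υ'.nat 7 0 = 2 * n from f7] at key
        obtain ⟨k1, k2, k3⟩ := key
        simp only [NExp.eval, FExp.eval, State.setFld_fld, true_and, k1, k2, k3, hv]
        split
        case isTrue heq => rw [heq, ← pow_mul, pow_succ]
        case isFalse hne => exact hI j (by omega)
      · refine ⟨by simp [hυ', NExp.eval, FExp.eval], ?_, ?_⟩
        · rw [State.setNat_fld, hυ', State.setFld_fld_of_ne _ (by decide : 3 ≠ 11)]
        · rw [State.setNat_nat_of_ne _ (by decide : 23 ≠ 24), hυ', State.setFld_nat]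
      · rintro k hk ρ hv' hN' hM' ⟨h1, h2, h3⟩
        rw [exec_setFld]
        refine ⟨?_, ?_, ?_⟩
        · simp only [State.setNat_fld, NExp.eval, FExp.eval, State.setFld_fld, and_self, if_true,
            h1, h2, h3, hv, hI i le_rfl, pow_succ]
        · rw [State.setNat_fld, State.setFld_fld_of_ne _ (by decide : 3 ≠ 11), h2]
        · rw [State.setNat_nat_of_ne _ (by decide : 23 ≠ 24), State.setFld_nat, h3]

theorem tableCmd_nat (d s : ℕ) :
    (tableCmd.exec O (start O d s)).nat 1 0 = 0 ∧ (tableCmd.exec O (start O d s)).nat 36 0 = 0 := by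
  rw [tableCmd.exec_nat O _ (by decide), tableCmd.exec_nat O _ (by decide)]
  simp [start, productCmd, sumCmd, Cmd.exec, NExp.eval, init]

end Setup

/-! ### Admissibility of all queries -/

section Safety

variable {F : Type*} [Field F] {n d s : ℕ} (O : Oracle F n) {σ : State F}

theorem Context.setNat (h : Context n d s σ) {a i v : ℕ} (ha : a ∉ constRegs) :
    Context n d s (σ.setNat a i v) :=
  h.of_eq (fun b hb => State.setNat_nat_of_ne _ (by rintro rfl; exact ha hb)) fun _ _ => rfl

/-- The context is an invariant of every loop that does not write to it. Since queries are
admissible for arbitrary weights, safety needs no information on the progress of the search. -/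
theorem Context.safe_loop (h : Context n d s σ) {v r : ℕ} {P : Cmd}
    (hN : ∀ a ∈ constRegs, a ∉ v :: P.nats) (hM : ∀ a ∈ [1, 2, 3], a ∉ P.flds)
    (hs : ∀ τ : State F, Context n d s τ → τ.nat v 0 < σ.nat r 0 → P.Safe O τ) :
    (Cmd.loop v r P).Safe O σ := by
  intro i hi
  have hv : v ∉ constRegs := fun hv => hN v hv (by simp)
  refine hs _ ?_ (by rwa [loopState_self])
  clear hi
  induction i with
  | zero => exact h.setNat hv
  | succ i ih =>
    exact (ih.exec O P (fun a ha hP => hN a ha (List.mem_cons_of_mem _ hP)) hM).setNat hv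

theorem safe_valueCmd (h : Context n d s σ) (hk : σ.nat 25 0 ≤ s) : valueCmd.Safe O σ :=
  ⟨(exec_queryCmd O h hk rfl).1, trivial, Cmd.safe_of_queryFree O _ _ (by decide)⟩

theorem safe_testCmd (h : Context n d s σ) : testCmd.Safe O σ := by
  refine h.safe_loop O (by decide) (by decide) fun τ hτ hv => ?_
  rw [h.sparsity] at hv
  exact ⟨safe_valueCmd O hτ hv.le, Cmd.safe_of_queryFree O _ _ (by decide)⟩

theorem safe_searchCmd (h : Context n d s σ) : searchCmd.Safe O σ := by
  refine h.safe_loop O (by decide) (by decide) fun τ hτ _ => ⟨fun _ => ⟨trivial, trivial, ?_⟩,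
    fun _ => trivial⟩
  refine Context.safe_loop O (n := n) (d := d) (s := s) ?_ (by decide) (by decide)
    fun υ hυ _ => ⟨fun _ => ⟨trivial, ?_⟩, fun _ => trivial⟩
  · exact (hτ.setNat (by decide)).setNat (by decide)
  · exact safe_testCmd O (hυ.setNat (by decide))

theorem safe_roundCmd (h : Context n d s σ) : roundCmd.Safe O σ := by
  have h1 : Context n d s ((Cmd.setNat 2 (.reg 1) (.reg 21)).exec O σ) := h.setNat (by decide)
  refine ⟨trivial, safe_searchCmd O h1, trivial, trivial, safe_valueCmd (d := d) (s := s) O ?_ ?_,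
    Cmd.safe_of_queryFree O _ _ (by decide)⟩
  · exact ((h1.exec O searchCmd (by decide) (by decide)).setNat (by decide)).setNat (by decide)
  · simp [exec_setNat, NExp.eval]

theorem safe_mainCmd (h : Context n d s σ) : mainCmd.Safe O σ := by
  refine h.safe_loop O (by decide) (by decide) fun τ hτ _ => ⟨trivial, ?_⟩
  refine Context.safe_loop O (n := n) (d := d) (s := s) ?_ (by decide) (by decide)
    fun υ hυ _ => safe_roundCmd O hυ
  exact hτ.setNat (by decide)

end Safety

end AlgRAM

namespace AlgRAM

/-! ### Correctness of the search -/

section Correctness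

theorem State.length_word {F : Type*} (σ : State F) (d x : ℕ) :
    (σ.word d x).length = σ.nat 2 x := by
  simp [State.word]

variable {F : Type*} [Field F] {n d s : ℕ} {f : FreeGroupAlgebra F n} {σ : State F}

/-- The memory contains the terms of `f` with the words in `l`. -/
structure Listing (f : FreeGroupAlgebra F n) (d : ℕ) (l : List (FreeGroup (Fin n)))
    (σ : State F) : Prop where
  nodup : l.Nodup
  mem : ∀ w ∈ l, w ∈ f.coeff.support
  count : σ.nat 1 0 = l.length
  position : σ.nat 36 0 = l.length * d
  word : ∀ x (hx : x < l.length), σ.word d x = wordCodes l[x]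
  coefficient : ∀ x (hx : x < l.length), σ.fld 0 x = f.coeff l[x]

variable {l : List (FreeGroup (Fin n))}

theorem norm_le_of_mem_support (hd : f.degree ≤ d) {w : FreeGroup (Fin n)}
    (hw : w ∈ f.coeff.support) : w.norm ≤ d :=
  (Finset.le_sup (f := FreeGroup.norm) hw).trans hd

theorem Listing.length_le [DecidableEq (FreeGroup (Fin n))] (h : Listing f d l σ)
    (hs : f.sparsity ≤ s) : l.length ≤ s := by
  rw [← List.toFinset_card_of_nodup h.nodup]
  refine (Finset.card_le_card fun w hw => ?_).trans hs
  exact h.mem w (List.mem_toFinset.1 hw)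

theorem Listing.nat_two (h : Listing f d l σ) {x : ℕ} (hx : x < l.length) :
    σ.nat 2 x = l[x].norm := by
  rw [← State.length_word σ d, h.word x hx, length_wordCodes]

theorem Listing.nat_two_le (h : Listing f d l σ) (hd : f.degree ≤ d) {x : ℕ} (hx : x < l.length) :
    σ.nat 2 x ≤ d := by
  rw [h.nat_two hx]
  exact norm_le_of_mem_support hd (h.mem _ (List.getElem_mem hx))

/-- Words have length at most `d`, so the known ones lie in the array 3 before the cell `l.length *
d`; the search may write behind it. -/
theorem Listing.of_eq (h : Listing f d l σ) (hd : f.degree ≤ d) {τ : State F}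
    (h1 : τ.nat 1 0 = σ.nat 1 0) (h36 : τ.nat 36 0 = σ.nat 36 0)
    (h2 : ∀ x < l.length, τ.nat 2 x = σ.nat 2 x)
    (h3 : ∀ j < l.length * d, τ.nat 3 j = σ.nat 3 j) (h0 : τ.fld 0 = σ.fld 0) :
    Listing f d l τ where
  nodup := h.nodup
  mem := h.mem
  count := h1.trans h.count
  position := h36.trans h.position
  word x hx := by
    rw [← h.word x hx, State.word, State.word, h2 x hx]
    refine List.map_congr_left fun j hj => h3 _ ?_
    have hj' := (List.mem_range.1 hj).trans_le (h.nat_two_le hd hx)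
    calc x * d + j < x * d + d := by omega
      _ = (x + 1) * d := by ring
      _ ≤ l.length * d := Nat.mul_le_mul_right _ hx
  coefficient x hx := by rw [h0]; exact h.coefficient x hx

theorem Listing.exec (O : Oracle F n) (h : Listing f d l σ) (P : Cmd)
    (hN : ∀ a ∈ [1, 2, 3, 36], a ∉ P.nats) (hM : 0 ∉ P.flds) : Listing f d l (P.exec O σ) where
  nodup := h.nodup
  mem := h.mem
  count := by rw [P.exec_nat O σ (hN 1 (by simp))]; exact h.count
  position := by rw [P.exec_nat O σ (hN 36 (by simp))]; exact h.position
  word x hx := by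
    rw [State.word, P.exec_nat O σ (hN 2 (by simp)), P.exec_nat O σ (hN 3 (by simp))]
    exact h.word x hx
  coefficient x hx := by rw [P.exec_fld O σ hM]; exact h.coefficient x hx

/-- The remaining words. -/
noncomputable def remaining (f : FreeGroupAlgebra F n) (l : List (FreeGroup (Fin n))) :
    Finset (FreeGroup (Fin n)) :=
  open Classical in f.coeff.support \ l.toFinset

theorem mem_remaining {w : FreeGroup (Fin n)} :
    w ∈ remaining f l ↔ w ∈ f.coeff.support ∧ w ∉ l := by
  classical
  simp [remaining]

theorem card_remaining_le : (remaining f l).card ≤ f.sparsity := by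
  classical
  exact Finset.card_le_card Finset.sdiff_subset

/-- Evaluation is linear in `f`: subtracting the contributions of the listed terms from the answer
leaves the sum over the remaining words. -/
theorem Listing.value (h : Listing f d l σ) (hctx : Context n d s σ) (hd : f.degree ≤ d)
    (hs : f.sparsity ≤ s) (hk : σ.nat 25 0 ≤ s) (hK : σ.nat 21 0 ≤ d) :
    (valueCmd.exec f.evalMatrix σ).fld 9 0 =
        testValue d (σ.nat 21 0) (remaining f l) f.coeff (fun j => σ.nat 3 (l.length * d + j))
          (σ.nat 37 0) (σ.nat 25 0) ∧
      (σ.nat 2 l.length ≤ d → (∀ c ∈ σ.word d l.length, c < 2 * n) →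
        (valueCmd.exec f.evalMatrix σ).fld 10 0 = wordVec (testWeight (2 * n)
          (fun j => σ.nat 3 (l.length * d + j)) (σ.nat 37 0) (σ.nat 25 0)) d
            (σ.word d l.length) (4 * σ.nat 21 0)) := by
  classical
  obtain ⟨-, h9, h10⟩ := exec_valueCmd f.evalMatrix hctx hk (by rw [h.count]; exact h.length_le hs)
    hK (by rw [h.count]; exact fun x hx => h.nat_two_le hd hx) (by
      rw [h.count]
      intro x hx c hc
      rw [h.word x hx] at hc
      exact lt_of_mem_wordCodes hc) rfl
  rw [h.count, h.position] at h9 h10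
  refine ⟨?_, h10⟩
  rw [h9, evalMatrix_letterUnit, testValue, remaining, Finset.sum_range]
  set W : ℕ → ℕ → F := testWeight (2 * n) (fun j => σ.nat 3 (l.length * d + j)) (σ.nat 37 0)
    (σ.nat 25 0) with hW
  have hsub : l.toFinset ⊆ f.coeff.support := fun w hw => h.mem w (List.mem_toFinset.1 hw)
  rw [← Finset.sum_sdiff hsub, add_sub_assoc, add_eq_left, sub_eq_zero,
    List.sum_toFinset _ h.nodup, ← Fin.sum_univ_fun_getElem]
  exact Finset.sum_congr rfl fun x _ => by rw [h.word x x.2, h.coefficient x x.2]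

theorem Listing.remaining_eq_empty (h : Listing f d l σ) (hl : f.sparsity ≤ l.length) :
    remaining f l = ∅ := by
  classical
  have hsub : l.toFinset ⊆ f.coeff.support := fun w hw => h.mem w (List.mem_toFinset.1 hw)
  rw [remaining, Finset.sdiff_eq_empty_iff_subset]
  refine (Finset.eq_of_subset_of_card_le hsub ?_).ge
  rwa [List.toFinset_card_of_nodup h.nodup]

theorem remaining_append_subset (w : FreeGroup (Fin n)) :
    remaining f (l ++ [w]) ⊆ remaining f l := by
  intro x hx
  rw [mem_remaining] at hx ⊢
  exact ⟨hx.1, fun hxl => hx.2 (List.mem_append_left _ hxl)⟩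

/-- There is a remaining word of length `K` with prefix `u` of length `m`. -/
def HasPrefix (f : FreeGroupAlgebra F n) (l : List (FreeGroup (Fin n))) (K : ℕ) (u : ℕ → ℕ)
    (m : ℕ) : Prop :=
  ∃ w ∈ remaining f l, w.norm = K ∧ ∀ t < m, (wordCodes w).getD t 0 = u t

variable [CharZero F]

/-- At most `s` words remain, so the exponents below `s` suffice for the Vandermonde test. The flag
is raised at the first nonzero value and never lowered here. -/
theorem exec_testCmd (h : Listing f d l σ) (hctx : Context n d s σ) (hd : f.degree ≤ d)
    (hs : f.sparsity ≤ s) (hK : σ.nat 21 0 ≤ d)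
    (hrem : ∀ w ∈ remaining f l, w.norm ≤ σ.nat 21 0) (hm : σ.nat 37 0 ≤ σ.nat 21 0) :
    let u := fun j => σ.nat 3 (l.length * d + j)
    (HasPrefix f l (σ.nat 21 0) u (σ.nat 37 0) →
        (testCmd.exec f.evalMatrix σ).nat 35 0 = 1) ∧
      (¬ HasPrefix f l (σ.nat 21 0) u (σ.nat 37 0) →
        (testCmd.exec f.evalMatrix σ).nat 35 0 = σ.nat 35 0) := by
  intro u
  set v : ℕ → F := testValue d (σ.nat 21 0) (remaining f l) f.coeff u (σ.nat 37 0) with hv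
  have key := exec_loop f.evalMatrix (v := 25) (r := 5) (σ := σ)
    (P := .seq valueCmd
      (.ite (.fldEq (.reg 9) .zero) .skip (.setNat 35 (.const 0) (.const 1))))
    (fun i τ => (τ.nat 35 0 = 1 ∧ ∃ k < i, v k ≠ 0) ∨
      (τ.nat 35 0 = σ.nat 35 0 ∧ ∀ k < i, v k = 0)) (Or.inr (by simp)) ?_
  · rw [hctx.sparsity] at key
    have hiff := exists_testValue_ne_zero_iff (a := f.coeff) (d := d) (s := s)
      (S := remaining f l) u (card_remaining_le.trans hs)
      (fun w hw => Finsupp.mem_support_iff.1 (mem_remaining.1 hw).1) hrem hK hm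
    constructor
    · intro hp
      obtain ⟨k, hk, hne⟩ := hiff.2 hp
      rcases key with hkey | hkey
      · exact hkey.1
      · exact absurd (hkey.2 k hk) hne
    · intro hp
      rcases key with hkey | hkey
      · exact absurd (hiff.1 hkey.2) hp
      · exact hkey.1
  · intro i hi τ hτ hN hM hI
    rw [hctx.sparsity] at hi
    have hctx' : Context n d s τ := hctx.of_frame hN hM (by decide) (by decide)
    have e3 : τ.nat 3 = σ.nat 3 := hN 3 (by decide)
    have e21 : τ.nat 21 = σ.nat 21 := hN 21 (by decide)
    have e37 : τ.nat 37 = σ.nat 37 := hN 37 (by decide)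
    have h' : Listing f d l τ := h.of_eq hd (by rw [hN 1 (by decide)]) (by rw [hN 36 (by decide)])
      (by rw [hN 2 (by decide)]; exact fun _ _ => rfl) (by rw [e3]; exact fun _ _ => rfl)
      (hM 0 (by decide))
    have hval := (h'.value hctx' hd hs (by omega) (by rwa [e21])).1
    rw [e3, e21, e37, hτ] at hval
    have e35 : (valueCmd.exec f.evalMatrix τ).nat 35 = τ.nat 35 :=
      valueCmd.exec_nat _ τ (by decide)
    rw [exec_seq, exec_ite]
    by_cases h0 : (Test.fldEq (.reg 9) .zero).holds (valueCmd.exec f.evalMatrix τ)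
    · rw [if_pos h0]
      replace h0 := hval.symm.trans h0
      rw [exec_skip, State.setNat_nat_of_ne _ (by decide : 35 ≠ 25), e35]
      rcases hI with ⟨hI, k, hk, hne⟩ | ⟨hI, hz⟩
      · exact Or.inl ⟨hI, k, by omega, hne⟩
      · refine Or.inr ⟨hI, fun k hk => ?_⟩
        rcases Nat.lt_succ_iff_lt_or_eq.1 hk with hk | rfl
        · exact hz k hk
        · exact h0
    · rw [if_neg h0]
      replace h0 := fun hz => h0 (hval.trans hz)
      refine Or.inl ⟨?_, i, by omega, h0⟩
      rw [State.setNat_nat_of_ne _ (by decide : 35 ≠ 25), exec_setNat]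
      simp [NExp.eval]

theorem exec_letterCmd (h : Listing f d l σ) (hctx : Context n d s σ) (hd : f.degree ≤ d)
    (hs : f.sparsity ≤ s) (hK : σ.nat 21 0 ≤ d)
    (hrem : ∀ w ∈ remaining f l, w.norm ≤ σ.nat 21 0) (ht : σ.nat 23 0 < σ.nat 21 0)
    (hm : σ.nat 37 0 = σ.nat 23 0 + 1) (h35 : σ.nat 35 0 = 0) :
    (∀ j, j ≠ l.length * d + σ.nat 23 0 → (letterCmd.exec f.evalMatrix σ).nat 3 j = σ.nat 3 j) ∧
      (HasPrefix f l (σ.nat 21 0) (fun j => σ.nat 3 (l.length * d + j)) (σ.nat 23 0) →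
        HasPrefix f l (σ.nat 21 0)
          (fun j => (letterCmd.exec f.evalMatrix σ).nat 3 (l.length * d + j))
          (σ.nat 23 0 + 1)) := by
  set t := σ.nat 23 0 with htdef
  set K := σ.nat 21 0 with hKdef
  have key := exec_loop f.evalMatrix (v := 24) (r := 7) (σ := σ)
    (P := .ite (.natEq (.reg 35) (.const 0))
      (.seq (.setNat 3 (.add (.reg 36) (.reg 23)) (.reg 24)) testCmd) .skip)
    -- Either a letter has been found, and the raised flag protects its cell from the later rounds,
    -- or all codes below `i` are excluded. At `i = 2 n` the second case leaves no possible letter.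
    (fun i τ => (∀ j, j ≠ l.length * d + t → τ.nat 3 j = σ.nat 3 j) ∧
      ((τ.nat 35 0 = 1 ∧ HasPrefix f l K (fun j => τ.nat 3 (l.length * d + j)) (t + 1)) ∨
      (τ.nat 35 0 = 0 ∧ ∀ w ∈ remaining f l, w.norm = K →
        (∀ j < t, (wordCodes w).getD j 0 = σ.nat 3 (l.length * d + j)) →
          i ≤ (wordCodes w).getD t 0))) ?_ ?_
  · rw [hctx.letters] at key
    refine ⟨key.1, fun ⟨w, hw, hwK, hp⟩ => ?_⟩
    rcases key.2 with hkey | hkey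
    · exact hkey.2
    · have h1 := hkey.2 w hw hwK hp
      have h2 := getD_wordCodes_lt (w := w) (t := t) (by omega)
      omega
  · refine ⟨fun j _ => ?_, Or.inr ⟨?_, fun w _ _ _ => Nat.zero_le _⟩⟩
    · rw [State.setNat_nat_of_ne _ (by decide : 3 ≠ 24)]
    · rw [State.setNat_nat_of_ne _ (by decide : 35 ≠ 24), h35]
  · intro i hi τ hv hN hM hI
    rw [State.setNat_nat_of_ne _ (by decide : 3 ≠ 24),
      State.setNat_nat_of_ne _ (by decide : 35 ≠ 24), exec_ite]
    by_cases h0 : (Test.natEq (.reg 35) (.const 0)).holds τ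
    swap
    · rw [if_neg h0, exec_skip]
      refine ⟨hI.1, Or.inl ?_⟩
      rcases hI.2 with hI' | hI'
      · exact hI'
      · exact absurd hI'.1 h0
    · rw [if_pos h0]
      replace h0 : τ.nat 35 0 = 0 := h0
      have hI2 := hI.2.resolve_left (fun hI' => by omega)
      have hctx' : Context n d s τ := hctx.of_frame hN hM (by decide) (by decide)
      have e36 : τ.nat 36 0 = l.length * d := by rw [hN 36 (by decide), h.position]
      have e23 : τ.nat 23 0 = t := by rw [hN 23 (by decide)]
      have e21 : τ.nat 21 0 = K := by rw [hN 21 (by decide)]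
      have e37 : τ.nat 37 0 = t + 1 := by rw [hN 37 (by decide), hm]
      rw [exec_seq, exec_setNat]
      simp only [NExp.eval, e36, e23, hv]
      set υ := τ.setNat 3 (l.length * d + t) i with hυ
      have hctx'' : Context n d s υ := hctx'.setNat (by decide)
      have g3 (j : ℕ) : υ.nat 3 j = if j = l.length * d + t then i else τ.nat 3 j := by
        simp [hυ]
      have gn (a : ℕ) (ha : a ≠ 3) : υ.nat a = τ.nat a := State.setNat_nat_of_ne _ ha
      have h' : Listing f d l υ := h.of_eq hd (by rw [gn 1 (by decide), hN 1 (by decide)])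
        (by rw [gn 36 (by decide), hN 36 (by decide)])
        (fun x _ => by rw [gn 2 (by decide), hN 2 (by decide)])
        (fun j hj => by rw [g3, if_neg (by omega), hI.1 j (by omega)])
        (hM 0 (by decide))
      have f21 : υ.nat 21 0 = K := by rw [gn 21 (by decide), e21]
      have f37 : υ.nat 37 0 = t + 1 := by rw [gn 37 (by decide), e37]
      obtain ⟨k1, k2⟩ := exec_testCmd h' hctx'' hd hs (by rwa [f21]) (by rwa [f21]) (by omega)
      rw [f21, f37] at k1 k2
      have f3 : (testCmd.exec f.evalMatrix υ).nat 3 = υ.nat 3 := testCmd.exec_nat _ υ (by decide)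
      rw [f3]
      refine ⟨fun j hj => by rw [g3, if_neg hj, hI.1 j hj], ?_⟩
      by_cases hp : HasPrefix f l K (fun j => υ.nat 3 (l.length * d + j)) (t + 1)
      · exact Or.inl ⟨k1 hp, hp⟩
      · refine Or.inr ⟨?_, fun w hw hwK hwp => ?_⟩
        · rw [k2 hp, gn 35 (by decide), h0]
        · have h1 := hI2.2 w hw hwK hwp
          rcases h1.lt_or_eq with hlt | heq
          · exact hlt
          · refine absurd ⟨w, hw, hwK, fun j hj => ?_⟩ hp
            simp only [g3]
            rcases Nat.lt_succ_iff_lt_or_eq.1 hj with hj | rfl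
            · rw [if_neg (by omega), hwp j hj, hI.1 _ (by omega)]
            · rw [if_pos rfl, heq]

/-- The empty prefix is extended greedily. Since the test is exact, every accepted prefix belongs to
a remaining word of length `K`, and no backtracking is needed. -/
theorem exec_searchCmd (h : Listing f d l σ) (hctx : Context n d s σ) (hd : f.degree ≤ d)
    (hs : f.sparsity ≤ s) (hK : σ.nat 21 0 ≤ d)
    (hrem : ∀ w ∈ remaining f l, w.norm ≤ σ.nat 21 0) :
    (∀ j < l.length * d, (searchCmd.exec f.evalMatrix σ).nat 3 j = σ.nat 3 j) ∧
      ((∃ w ∈ remaining f l, w.norm = σ.nat 21 0) → HasPrefix f l (σ.nat 21 0)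
        (fun j => (searchCmd.exec f.evalMatrix σ).nat 3 (l.length * d + j)) (σ.nat 21 0)) := by
  set K := σ.nat 21 0 with hKdef
  have key := exec_loop f.evalMatrix (v := 23) (r := 4) (σ := σ)
    (P := .ite (.natLt (.reg 23) (.reg 21))
    (.seq (.setNat 35 (.const 0) (.const 0))
      (.seq (.setNat 37 (.const 0) (.add (.reg 23) (.const 1))) letterCmd)) .skip)
    (fun i τ => (∀ j < l.length * d, τ.nat 3 j = σ.nat 3 j) ∧
      ((∃ w ∈ remaining f l, w.norm = K) →
        HasPrefix f l K (fun j => τ.nat 3 (l.length * d + j)) (min i K))) ?_ ?_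
  · rwa [hctx.degree, min_eq_right hK] at key
  · refine ⟨fun j _ => ?_, fun ⟨w, hw, hwK⟩ => ⟨w, hw, hwK, fun t ht => by omega⟩⟩
    rw [State.setNat_nat_of_ne _ (by decide : 3 ≠ 23)]
  · intro i hi τ hv hN hM hI
    have hctx' : Context n d s τ := hctx.of_frame hN hM (by decide) (by decide)
    have e21 : τ.nat 21 0 = K := by rw [hN 21 (by decide)]
    rw [State.setNat_nat_of_ne _ (by decide : 3 ≠ 23), exec_ite]
    simp only [Test.holds, NExp.eval, hv, e21]
    split
    case isFalse hge =>
      rw [exec_skip, min_eq_right (by omega)]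
      rwa [min_eq_right (by omega)] at hI
    case isTrue hlt =>
      rw [exec_seq, exec_seq, exec_setNat, exec_setNat]
      simp only [NExp.eval]
      set υ := (τ.setNat 35 0 0).setNat 37 0 ((τ.setNat 35 0 0).nat 23 0 + 1) with hυ
      have gn (a : ℕ) (ha : a ≠ 35) (ha' : a ≠ 37) : υ.nat a = τ.nat a :=
        (State.setNat_nat_of_ne _ ha').trans (State.setNat_nat_of_ne _ ha)
      have hctx'' : Context n d s υ := (hctx'.setNat (by decide)).setNat (by decide)
      have h' : Listing f d l υ := h.of_eq hd
        (by rw [gn 1 (by decide) (by decide), hN 1 (by decide)])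
        (by rw [gn 36 (by decide) (by decide), hN 36 (by decide)])
        (fun x _ => by rw [gn 2 (by decide) (by decide), hN 2 (by decide)])
        (fun j hj => by rw [gn 3 (by decide) (by decide), hI.1 j hj])
        (hM 0 (by decide))
      have f21 : υ.nat 21 0 = K := by rw [gn 21 (by decide) (by decide), e21]
      have f23 : υ.nat 23 0 = i := by rw [gn 23 (by decide) (by decide), hv]
      have f3 : υ.nat 3 = τ.nat 3 := gn 3 (by decide) (by decide)
      obtain ⟨k1, k2⟩ := exec_letterCmd h' hctx'' hd hs (by rwa [f21]) (by rwa [f21])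
        (by omega) (by rw [f23]; simp [hυ, hv]) (by simp [hυ])
      rw [f23, f3] at k1
      rw [f21, f23, f3] at k2
      refine ⟨fun j hj => by rw [k1 j (by omega), hI.1 j hj], fun hex => ?_⟩
      rw [min_eq_left (by omega)]
      have := hI.2 hex
      rw [min_eq_left (by omega)] at this
      exact k2 this

/-- Whether a word of length `K` remains need not be known beforehand: the search leaves some
candidate in any case, and the value at the full prefix is nonzero exactly if the candidate is a
remaining word. -/
theorem exec_roundCmd (h : Listing f d l σ) (hctx : Context n d s σ) (hd : f.degree ≤ d)
    (hs : f.sparsity ≤ s) (hK : σ.nat 21 0 ≤ d)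
    (hrem : ∀ w ∈ remaining f l, w.norm ≤ σ.nat 21 0) :
    (Listing f d l (roundCmd.exec f.evalMatrix σ) ∧
        ¬ ∃ w ∈ remaining f l, w.norm = σ.nat 21 0) ∨
      ∃ w ∈ remaining f l, w.norm = σ.nat 21 0 ∧
        Listing f d (l ++ [w]) (roundCmd.exec f.evalMatrix σ) := by
  set K := σ.nat 21 0 with hKdef
  set A : Cmd := .setNat 2 (.reg 1) (.reg 21) with hA
  set σ₁ := A.exec f.evalMatrix σ with hσ₁
  have n1 (a : ℕ) (ha : a ≠ 2) : σ₁.nat a = σ.nat a := State.setNat_nat_of_ne _ ha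
  -- The length of the candidate is entered at the first free position, so the listing is not
  -- affected.
  have n12 (x : ℕ) : σ₁.nat 2 x = if x = l.length then K else σ.nat 2 x := by
    simp [hσ₁, hA, exec_setNat, NExp.eval, h.count, hKdef]
  have hctx₁ : Context n d s σ₁ := hctx.exec _ A (by decide) (by decide)
  have h₁ : Listing f d l σ₁ := h.of_eq hd (by rw [n1 1 (by decide)]) (by rw [n1 36 (by decide)])
    (fun x hx => by rw [n12, if_neg (by omega)]) (fun j _ => by rw [n1 3 (by decide)]) rfl
  have e21 : σ₁.nat 21 0 = K := by rw [n1 21 (by decide)]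
  obtain ⟨k1, k2⟩ := exec_searchCmd h₁ hctx₁ hd hs (by rwa [e21]) (by rwa [e21])
  rw [e21] at k2
  set σ₂ := searchCmd.exec f.evalMatrix σ₁ with hσ₂
  have n2 (a : ℕ) (ha : a ∉ searchCmd.nats) : σ₂.nat a = σ₁.nat a := searchCmd.exec_nat _ _ ha
  set σ₃ := (σ₂.setNat 37 0 K).setNat 25 0 0 with hσ₃
  have n3 (a : ℕ) (ha : a ≠ 37) (ha' : a ≠ 25) : σ₃.nat a = σ₂.nat a :=
    (State.setNat_nat_of_ne _ ha').trans (State.setNat_nat_of_ne _ ha)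
  have hctx₃ : Context n d s σ₃ :=
    ((hctx₁.exec _ searchCmd (by decide) (by decide)).setNat (by decide)).setNat (by decide)
  have h₃ : Listing f d l σ₃ := h₁.of_eq hd
    (by rw [n3 1 (by decide) (by decide), n2 1 (by decide)])
    (by rw [n3 36 (by decide) (by decide), n2 36 (by decide)])
    (fun x _ => by rw [n3 2 (by decide) (by decide), n2 2 (by decide)])
    (fun j hj => by rw [n3 3 (by decide) (by decide), k1 j hj])
    (searchCmd.exec_fld _ _ (by decide))
  have e3 : σ₃.nat 3 = σ₂.nat 3 := n3 3 (by decide) (by decide)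
  have f21 : σ₃.nat 21 0 = K := by
    rw [n3 21 (by decide) (by decide), n2 21 (by decide), e21]
  have f37 : σ₃.nat 37 0 = K := by simp [hσ₃]
  have f25 : σ₃.nat 25 0 = 0 := by simp [hσ₃]
  have f2 : σ₃.nat 2 l.length = K := by
    rw [n3 2 (by decide) (by decide), n2 2 (by decide), n12, if_pos rfl]
  obtain ⟨v1, v2⟩ := h₃.value hctx₃ hd hs (by omega) (by rwa [f21])
  rw [f21, f37, f25] at v1 v2
  set u : ℕ → ℕ := fun j => σ₃.nat 3 (l.length * d + j) with hu
  set σ₄ := valueCmd.exec f.evalMatrix σ₃ with hσ₄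
  have h₄ : Listing f d l σ₄ := h₃.exec _ valueCmd (by decide) (by decide)
  have hexec : roundCmd.exec f.evalMatrix σ =
      (Cmd.ite (.fldEq (.reg 9) .zero) .skip appendCmd).exec f.evalMatrix σ₄ := by
    have g21 : σ₂.nat 21 0 = K := by rw [n2 21 (by decide), e21]
    rw [hσ₄, hσ₃, ← g21]
    rfl
  rw [hexec, exec_ite]
  by_cases h0 : (Test.fldEq (.reg 9) .zero).holds σ₄
  · rw [if_pos h0]
    replace h0 := v1.symm.trans h0
    refine Or.inl ⟨h₄, fun hex => ?_⟩
    obtain ⟨w, hw, hwK, hp⟩ := k2 hex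
    obtain ⟨hne, heq⟩ := testValue_eq (k := 0) (a := f.coeff) u hrem hK hw hwK (by
      intro t ht
      rw [hp t ht, hu, e3])
    rw [heq] at h0
    exact mul_ne_zero (Finsupp.mem_support_iff.1 (mem_remaining.1 hw).1) hne h0
  · rw [if_neg h0]
    replace h0 := fun hz => h0 (v1.trans hz)
    obtain ⟨w, hw, hwK, hp⟩ : ∃ w ∈ remaining f l, w.norm = K ∧
        ∀ t < K, (wordCodes w).getD t 0 = u t := by
      by_contra hcon
      exact h0 (testValue_eq_zero u hrem hK hcon)
    obtain ⟨hne, heq⟩ := testValue_eq (k := 0) (a := f.coeff) u hrem hK hw hwK hp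
    -- The nonzero value identifies the stored candidate with a remaining word, so the register 10
    -- holds the value of precisely this word.
    have hword : σ₃.word d l.length = wordCodes w := by
      apply List.ext_getElem
      · rw [State.length_word, f2, length_wordCodes, hwK]
      · intro t h1 h2
        have := hp t (by rwa [length_wordCodes, hwK] at h2)
        rw [List.getD_eq_getElem _ _ h2] at this
        simp [State.word, this, hu]
    rw [hword, f2] at v2
    have v2' := v2 hK fun c hc => lt_of_mem_wordCodes hc
    refine Or.inr ⟨w, hw, hwK, ?_⟩
    set τ := appendCmd.exec f.evalMatrix σ₄ with hτ
    have t1 : τ.nat 1 0 = l.length + 1 := by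
      simp [hτ, appendCmd, Cmd.exec, NExp.eval, h₄.count]
    have hd4 : σ₄.nat 4 0 = d := (hctx₃.exec _ valueCmd (by decide) (by decide)).degree
    have t36 : τ.nat 36 0 = (l.length + 1) * d := by
      simp [hτ, appendCmd, Cmd.exec, NExp.eval, h₄.position, hd4]
      ring
    have tn (a : ℕ) (ha : a ∉ appendCmd.nats) : τ.nat a = σ₄.nat a := appendCmd.exec_nat _ _ ha
    have tword (x : ℕ) : τ.word d x = σ₄.word d x := by
      simp only [State.word, tn 2 (by decide), tn 3 (by decide)]
    have word4 : σ₄.word d l.length = wordCodes w := by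
      rw [← hword]
      simp only [State.word, hσ₄, valueCmd.exec_nat f.evalMatrix σ₃ (by decide : 2 ∉ valueCmd.nats),
        valueCmd.exec_nat f.evalMatrix σ₃ (by decide : 3 ∉ valueCmd.nats)]
    have t0 (x : ℕ) : τ.fld 0 x = if x = l.length then f.coeff w else σ₄.fld 0 x := by
      have : τ.fld 0 x = if x = l.length then σ₄.fld 9 0 * (σ₄.fld 10 0)⁻¹ else σ₄.fld 0 x := by
        simp [hτ, appendCmd, Cmd.exec, NExp.eval, FExp.eval, h₄.count]
      rw [this, v1, heq, v2', mul_assoc, mul_inv_cancel₀ hne, mul_one]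
    have hwl := mem_remaining.1 hw
    exact {
      nodup := by
        rw [List.nodup_append]
        refine ⟨h.nodup, by simp, ?_⟩
        intro a ha b hb
        rw [List.mem_singleton] at hb
        rintro rfl
        exact hwl.2 (hb ▸ ha)
      mem := by
        intro x hx
        rcases List.mem_append.1 hx with hx | hx
        · exact h.mem x hx
        · rw [List.mem_singleton] at hx
          exact hx ▸ hwl.1
      count := by rw [t1]; simp
      position := by rw [t36]; simp
      word := by
        intro x hx
        rw [tword]
        rcases Nat.lt_succ_iff_lt_or_eq.1 (by simpa using hx : x < l.length + 1) with hx' | rfl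
        · rw [List.getElem_append_left hx', h₄.word x hx']
        · rw [word4]; simp
      coefficient := by
        intro x hx
        rw [t0]
        rcases Nat.lt_succ_iff_lt_or_eq.1 (by simpa using hx : x < l.length + 1) with hx' | rfl
        · rw [if_neg (by omega), List.getElem_append_left hx', h₄.coefficient x hx']
        · rw [if_pos rfl]; simp }

/-- After `i` lengths all remaining words have length below `d + 1 - i`; after `d + 1` lengths, the
last being that of the empty word, none is left. -/
theorem exec_mainCmd (h : Listing f d [] σ) (hctx : Context n d s σ) (hd : f.degree ≤ d)
    (hs : f.sparsity ≤ s) :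
    ∃ l, Listing f d l (mainCmd.exec f.evalMatrix σ) ∧ remaining f l = ∅ := by
  have key := exec_loop f.evalMatrix (v := 20) (r := 11) (σ := σ)
    (P := .seq (.setNat 21 (.const 0) (.sub (.reg 4) (.reg 20))) (.loop 22 5 roundCmd))
    (fun i τ => ∃ l, Listing f d l τ ∧ ∀ w ∈ remaining f l, w.norm + i ≤ d) ?_ ?_
  · rw [hctx.levels] at key
    obtain ⟨l, h1, h2⟩ := key
    refine ⟨l, h1, Finset.eq_empty_of_forall_notMem fun w hw => ?_⟩
    have := h2 w hw
    omega
  · refine ⟨[], h.of_eq hd ?_ ?_ ?_ ?_ rfl, fun w hw => ?_⟩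
    · rw [State.setNat_nat_of_ne _ (by decide : 1 ≠ 20)]
    · rw [State.setNat_nat_of_ne _ (by decide : 36 ≠ 20)]
    · rw [State.setNat_nat_of_ne _ (by decide : 2 ≠ 20)]; exact fun _ _ => rfl
    · rw [State.setNat_nat_of_ne _ (by decide : 3 ≠ 20)]; exact fun _ _ => rfl
    · exact norm_le_of_mem_support hd (mem_remaining.1 hw).1
  · rintro i hi τ hv hN hM ⟨l, hl, hrem⟩
    rw [hctx.levels] at hi
    have hctx' : Context n d s τ := hctx.of_frame hN hM (by decide) (by decide)
    rw [exec_seq, exec_setNat]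
    simp only [NExp.eval, hctx'.degree, hv]
    set υ := τ.setNat 21 0 (d - i) with hυ
    have gn (a : ℕ) (ha : a ≠ 21) : υ.nat a = τ.nat a := State.setNat_nat_of_ne _ ha
    have hctx'' : Context n d s υ := hctx'.setNat (by decide)
    have hl' : Listing f d l υ := hl.of_eq hd (by rw [gn 1 (by decide)]) (by rw [gn 36 (by decide)])
      (by rw [gn 2 (by decide)]; exact fun _ _ => rfl)
      (by rw [gn 3 (by decide)]; exact fun _ _ => rfl) rfl
    have f21 : υ.nat 21 0 = d - i := by simp [hυ]
    have key := exec_loop f.evalMatrix (v := 22) (r := 5) (σ := υ) (P := roundCmd)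
      -- A round either shows that the length is exhausted or lengthens the list. After `s`
      -- successful rounds the list has at least `s` terms, hence contains all of them.
      (fun k ρ => ∃ l, Listing f d l ρ ∧ (∀ w ∈ remaining f l, w.norm ≤ d - i) ∧
        ((¬ ∃ w ∈ remaining f l, w.norm = d - i) ∨ k ≤ l.length)) ?_ ?_
    · rw [hctx''.sparsity] at key
      obtain ⟨l', h1, h2, h3⟩ := key
      refine ⟨l', h1.of_eq hd ?_ ?_ ?_ ?_ rfl, fun w hw => ?_⟩
      · rw [State.setNat_nat_of_ne _ (by decide : 1 ≠ 20)]
      · rw [State.setNat_nat_of_ne _ (by decide : 36 ≠ 20)]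
      · rw [State.setNat_nat_of_ne _ (by decide : 2 ≠ 20)]; exact fun _ _ => rfl
      · rw [State.setNat_nat_of_ne _ (by decide : 3 ≠ 20)]; exact fun _ _ => rfl
      · have h4 := h2 w hw
        have h5 : w.norm ≠ d - i := by
          intro heq
          rcases h3 with h3 | h3
          · exact h3 ⟨w, hw, heq⟩
          · rw [h1.remaining_eq_empty (hs.trans h3)] at hw
            simp at hw
        omega
    · refine ⟨l, hl'.of_eq hd ?_ ?_ ?_ ?_ rfl, fun w hw => ?_, Or.inr (Nat.zero_le _)⟩
      · rw [State.setNat_nat_of_ne _ (by decide : 1 ≠ 22)]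
      · rw [State.setNat_nat_of_ne _ (by decide : 36 ≠ 22)]
      · rw [State.setNat_nat_of_ne _ (by decide : 2 ≠ 22)]; exact fun _ _ => rfl
      · rw [State.setNat_nat_of_ne _ (by decide : 3 ≠ 22)]; exact fun _ _ => rfl
      · have := hrem w hw
        omega
    · rintro k hk ρ hv' hN' hM' ⟨l, h1, h2, h3⟩
      have hctxρ : Context n d s ρ := hctx''.of_frame hN' hM' (by decide) (by decide)
      have g21 : ρ.nat 21 0 = d - i := by rw [hN' 21 (by decide), f21]
      have step {l' : List (FreeGroup (Fin n))}
          (h : Listing f d l' (roundCmd.exec f.evalMatrix ρ)) :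
          Listing f d l' ((roundCmd.exec f.evalMatrix ρ).setNat 22 0 (k + 1)) := by
        refine h.of_eq hd ?_ ?_ ?_ ?_ rfl
        · rw [State.setNat_nat_of_ne _ (by decide : 1 ≠ 22)]
        · rw [State.setNat_nat_of_ne _ (by decide : 36 ≠ 22)]
        · rw [State.setNat_nat_of_ne _ (by decide : 2 ≠ 22)]; exact fun _ _ => rfl
        · rw [State.setNat_nat_of_ne _ (by decide : 3 ≠ 22)]; exact fun _ _ => rfl
      rcases exec_roundCmd h1 hctxρ hd hs (by omega) (by rwa [g21]) with ⟨r1, r2⟩ | ⟨w, hw, hwK, r⟩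
      · rw [g21] at r2
        exact ⟨l, step r1, h2, Or.inl r2⟩
      · rw [g21] at hwK
        refine ⟨l ++ [w], step r, fun x hx => h2 x (remaining_append_subset w hx), Or.inr ?_⟩
        rcases h3 with h3 | h3
        · exact absurd ⟨w, hw, hwK⟩ h3
        · simpa using h3

end Correctness

end AlgRAM

namespace AlgRAM

/-! ### The polynomial time bound and the theorem -/

/-- The program that reconstructs a sparse expression. -/
def reconstructProg : Prog :=
  .seq sumCmd.toProg (.seq productCmd.toProg (.seq tableCmd.toProg mainCmd.toProg))

/-- A bound for all loop lengths and constants on the input `(n, d, s)`. -/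
noncomputable def sizeBound : MvPolynomial (Fin 3) ℕ :=
  let n := MvPolynomial.X 0
  let d := MvPolynomial.X 1
  let s := MvPolynomial.X 2
  2 * n + d * (2 * n) + (s + 1) + 4 * (d + 1) + n * (4 * (d + 1)) * (4 * (d + 1))

/-- A bound for the running time of the reconstruction. -/
noncomputable def timeBound : MvPolynomial (Fin 3) ℕ :=
  (sumCmd.time + productCmd.time + tableCmd.time + mainCmd.time).eval₂ MvPolynomial.C sizeBound

theorem eval_sizeBound (n d s : ℕ) : MvPolynomial.eval ![n, d, s] sizeBound =
    2 * n + d * (2 * n) + (s + 1) + 4 * (d + 1) + n * (4 * (d + 1)) * (4 * (d + 1)) := by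
  simp [sizeBound]

/-- Evaluation is a ring homomorphism, and ℕ has only one ring endomorphism, so the coefficients are
unchanged. -/
theorem eval_eval₂_C {ι : Type*} (p : Polynomial ℕ) (q : MvPolynomial ι ℕ) (v : ι → ℕ) :
    MvPolynomial.eval v (p.eval₂ MvPolynomial.C q) = p.eval (MvPolynomial.eval v q) := by
  rw [Polynomial.hom_eval₂, Subsingleton.elim ((MvPolynomial.eval v).comp MvPolynomial.C)
    (RingHom.id ℕ), Polynomial.eval₂_id]

variable {F : Type*} [Field F] {n d s : ℕ}

theorem Context.le_sizeBound {σ : State F} (h : Context n d s σ) :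
    ∀ r ∈ constRegs, σ.nat r 0 ≤ MvPolynomial.eval ![n, d, s] sizeBound := by
  rw [eval_sizeBound]
  intro r hr
  simp only [constRegs, List.mem_cons, List.not_mem_nil, or_false] at hr
  rcases hr with rfl | rfl | rfl | rfl | rfl | rfl | rfl | rfl | rfl
  · rw [h.rank]; omega
  · rw [h.degree]; omega
  · rw [h.sparsity]; omega
  · rw [h.terms]; omega
  · rw [h.letters]; omega
  · rw [h.dim]; omega
  · rw [h.entries]; omega
  · rw [h.weights]; omega
  · rw [h.levels]; omega

/-- The four parts are run with different protected registers: the sums need none, the products need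
the registers just computed, and the tables and the search need all constants. Later parts do not
overwrite these, so the final context bounds them at every stage. -/
theorem run_reconstructProg (O : Oracle F n) (d s : ℕ) :
    ∃ t ≤ MvPolynomial.eval ![n, d, s] timeBound, Run O reconstructProg (init F n d s) t
      (mainCmd.exec O (tableCmd.exec O (start O d s))) := by
  set B := MvPolynomial.eval ![n, d, s] sizeBound with hB
  have hctx := context_tableCmd O d s
  have hle := hctx.le_sizeBound
  have hstart (r : ℕ) (hr : r ∈ constRegs) : (start O d s).nat r 0 ≤ B := by
    rw [← tableCmd.exec_nat O (start O d s) (a := r) (by revert r; decide)]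
    exact hle r hr
  have hsum (r : ℕ) (hr : r ∈ [0, 4, 7, 8]) : (sumCmd.exec O (init F n d s)).nat r 0 ≤ B := by
    rw [← productCmd.exec_nat O (sumCmd.exec O (init F n d s)) (a := r) (by revert r; decide)]
    exact hstart r (by revert r; decide)
  have hn : n ≤ B := by
    have := hle 0 (by decide)
    rwa [hctx.rank] at this
  obtain ⟨t₁, h₁, r₁⟩ := Cmd.run O hn sumCmd (Γ := []) (init F n d s) (by decide) (by simp)
    (Cmd.safe_of_queryFree O _ _ (by decide))
  obtain ⟨t₂, h₂, r₂⟩ := Cmd.run O hn productCmd (Γ := [0, 4, 7, 8]) _ (by decide) hsum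
    (Cmd.safe_of_queryFree O _ _ (by decide))
  obtain ⟨t₃, h₃, r₃⟩ := Cmd.run O hn tableCmd (Γ := constRegs) _ (by decide) hstart
    (Cmd.safe_of_queryFree O _ _ (by decide))
  obtain ⟨t₄, h₄, r₄⟩ := Cmd.run O hn mainCmd (Γ := constRegs) _ (by decide) hle
    (safe_mainCmd O hctx)
  refine ⟨_, ?_, r₁.seq (r₂.seq (r₃.seq r₄))⟩
  rw [timeBound, eval_eval₂_C, ← hB]
  simp only [Polynomial.eval_add]
  omega

variable {f : FreeGroupAlgebra F n} {σ : State F} {l : List (FreeGroup (Fin n))}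

theorem exists_listing [CharZero F] (hd : f.degree ≤ d) (hs : f.sparsity ≤ s) :
    ∃ l, Listing f d l (mainCmd.exec f.evalMatrix (tableCmd.exec f.evalMatrix
      (start f.evalMatrix d s))) ∧ remaining f l = ∅ := by
  obtain ⟨h1, h2⟩ := tableCmd_nat f.evalMatrix d s
  exact exec_mainCmd ⟨List.nodup_nil, by simp, h1, by simpa using h2, by simp, by simp⟩
    (context_tableCmd f.evalMatrix d s) hd hs

theorem Listing.mem_iff (h : Listing f d l σ) (hr : remaining f l = ∅) (w : FreeGroup (Fin n)) :
    w ∈ l ↔ f.coeff w ≠ 0 := by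
  rw [← Finsupp.mem_support_iff]
  refine ⟨h.mem w, fun hw => ?_⟩
  by_contra hwl
  have : w ∈ remaining f l := mem_remaining.2 ⟨hw, hwl⟩
  simp [hr] at this

theorem Listing.isSparseRepresentation (h : Listing f d l σ) (hr : remaining f l = ∅) :
    IsSparseRepresentation (σ.terms d) f := by
  refine ⟨l, h.nodup, h.mem_iff hr, ?_⟩
  apply List.ext_getElem
  · simp [State.terms, h.count]
  · intro x h1 h2
    have hx : x < l.length := by simpa using h2
    have hw := h.word x hx
    simp only [State.word] at hw
    simp [State.terms, h.coefficient x hx, hw, wordCodes]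

theorem Listing.eq_zero_iff (h : Listing f d l σ) (hr : remaining f l = ∅) :
    f = 0 ↔ σ.nat 1 0 = 0 := by
  rw [h.count, List.length_eq_zero_iff, List.eq_nil_iff_forall_not_mem]
  simp only [h.mem_iff hr, not_not]
  constructor
  · rintro rfl w
    simp
  · intro hf
    ext w
    simpa using hf w

end AlgRAM

theorem theorem3 :
    (∃ (P : AlgRAM.Prog) (p : MvPolynomial (Fin 3) ℕ),
      ∀ (F : Type*) [Field F] [CharZero F] (n d s : ℕ) (f : FreeGroupAlgebra F n),
        FreeGroupAlgebra.degree f ≤ d → FreeGroupAlgebra.sparsity f ≤ s →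
          ∃ (t : ℕ) (σ : AlgRAM.State F),
            AlgRAM.Run (FreeGroupAlgebra.evalMatrix f) P (AlgRAM.init F n d s) t σ ∧
            t ≤ MvPolynomial.eval ![n, d, s] p ∧
            AlgRAM.IsSparseRepresentation (σ.terms d) f) ∧
    (∃ (P : AlgRAM.Prog) (p : MvPolynomial (Fin 3) ℕ),
      ∀ (F : Type*) [Field F] [CharZero F] (n d s : ℕ) (f : FreeGroupAlgebra F n),
        FreeGroupAlgebra.degree f ≤ d → FreeGroupAlgebra.sparsity f ≤ s →
          ∃ (t : ℕ) (σ : AlgRAM.State F),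
            AlgRAM.Run (FreeGroupAlgebra.evalMatrix f) P (AlgRAM.init F n d s) t σ ∧
            t ≤ MvPolynomial.eval ![n, d, s] p ∧
            (f = 0 → σ.answer = 1) ∧ (f ≠ 0 → σ.answer = 0)) := by
  refine ⟨⟨AlgRAM.reconstructProg, AlgRAM.timeBound, fun F _ _ n d s f hd hs => ?_⟩,
    ⟨.seq AlgRAM.reconstructProg (.ite (.natEq (.get 1 (.const 0)) (.const 0))
      (.setNat 1 (.const 0) (.const 1)) (.setNat 1 (.const 0) (.const 0))),
      -- The additional 7 steps are 4 for the test and 3 for the assignment.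
      AlgRAM.timeBound + 7, fun F _ _ n d s f hd hs => ?_⟩⟩
  · obtain ⟨t, ht, hrun⟩ := AlgRAM.run_reconstructProg f.evalMatrix d s
    obtain ⟨l, hl, hr⟩ := AlgRAM.exists_listing hd hs
    exact ⟨t, _, hrun, ht, hl.isSparseRepresentation hr⟩
  · obtain ⟨t, ht, hrun⟩ := AlgRAM.run_reconstructProg f.evalMatrix d s
    obtain ⟨l, hl, hr⟩ := AlgRAM.exists_listing hd hs
    have hzero := hl.eq_zero_iff hr
    by_cases hf : f = 0
    · refine ⟨_, _, hrun.seq (.iteTrue _ (hzero.1 hf) (.setNat _ _ _ _)), ?_, fun _ => ?_,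
        fun h => absurd hf h⟩
      · simp [AlgRAM.Test.cost, AlgRAM.NExp.cost, ht]
      · simp [AlgRAM.State.answer, AlgRAM.NExp.eval]
    · refine ⟨_, _, hrun.seq (.iteFalse _ (fun h => hf (hzero.2 h)) (.setNat _ _ _ _)), ?_,
        fun h => absurd h hf, fun _ => ?_⟩
      · simp [AlgRAM.Test.cost, AlgRAM.NExp.cost, ht]
      · simp [AlgRAM.State.answer, AlgRAM.NExp.eval]
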